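/- Let $K$ be a field. A tensor over $K$ is a trilinear form $\sum t_{ijl}\,x_iy_jz_l$ in three finite sets of variables. Write $S\le T$ ($S$ is a restriction of $T$) if $S=T\circ(A,B,C)$ for some linear maps $A,B,C$. Let $\otimes$ and $\oplus$ be the Kronecker product and the direct sum, $\langle r\rangle=\sum_{i=1}^r x_iy_iz_i$, and $\langle a,b,c\rangle=\sum_{i=1}^a\sum_{j=1}^b\sum_{l=1}^c x_{ij}y_{jl}z_{li}$. Let $\mathrm R(T)$ be the least $r$ with $T\le\langle r\rangle$, and $\tilde{\mathrm R}(T)=\lim_n \mathrm R(T^{\otimes n})^{1/n}$. For a probability vector $\theta=(\theta_1,\theta_2,\theta_3)$, the upper support functional is $$\zeta^\theta(T)=\min_{S\cong T}\ \max_{P}\ 2^{\theta_1H(P_1)+\theta_2H(P_2)+\theta_3H(P_3)},$$ where $S$ runs over the tensors $T\circ(A,B,C)$ with $A,B,C$ invertible, $P$ over the probability distributions on the support of $S$, $P_i$ is the $i$-th marginal of $P$, and $H$ is the Shannon entropy in bits; $\zeta^\theta(0)=0$. Let $\mathcal F$ be the class of maps $F:\{\text{tensors over }K\}\to\mathbb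 R_{\ge0}$ that consists of all upper support functionals and of all maps that satisfy $F(\langle1\rangle)=1$, are $\le$-monotone, $\otimes$-submultiplicative, $\otimes$-multiplicative on pairs of matrix multiplication tensors, $\oplus$-additive, and at most $\tilde{\mathrm R}$. For $F\in\mathcal F$ and real $p\ge0$ define $$F(\langle2,2,2^p\rangle)=2^{\log_aF(\langle a,a,b\rangle)}\quad\text{if }p=\log_ab\text{ for integers }a\ge2,\ b\ge1$$ (this does not depend on the choice of $a$ and $b$), and otherwise let $F(\langle2,2,2^p\rangle)$ be the infimum of $F(\langle2,2,2^P\rangle)$ over all $P\ge p$ of the form $P=\log_ab$. A sequence of tensors $\{T_n\}$ is almost exponential if $\tilde{\mathrm R}(T_n)^{1/n}$ converges and $F(T_n)^{1/n}$ is bounded for each $F\in\mathcal F$; then write $\tilde{\mathrm R}(\{T_n\})=\lim_n\tilde{\mathrm R}(T_n)^{1/n}$ and $F(\{T_n\})=\limsup_nF(T_n)^{1/n}$. Given such a sequence, an asymptotic mixed $\{T_n\}$-method for $\omega(p)$ (the exponent of multiplying $n\times n$ by $n\times\lceil n^p\rceil$ matrices) consists of a real number $r\ge\tilde{\mathrm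 R}(\{T_n\})$ and a collection of valid inequalities $\langle n,n,m\rangle^{\oplus s}\le T_k$ with $s\ge1$, in which the values of $n$ are unbounded, $m\ge f(n)$ for some $f(n)=n^{p+o(1)}$, and $$\tilde{\mathrm R}(T_k)\le r^k\,n^{o(1)}\qquad(n\to\infty\text{ in the collection}).$$ The last condition holds automatically if $r>\tilde{\mathrm R}(\{T_n\})$, if $k=O(\log n)$ in the collection, or if $T_n=T^{\otimes n}$ for a fixed tensor $T$. The method gives the bound $$\hat\omega(p)=\liminf_{n\to\infty}\{k\log_nr-\log_ns\}\in[-\infty,\infty],$$ taken over all $(k,n,s)$ that appear in the collection. For $\kappa\ge0$ the method is $\kappa$-catalytic if there is a constant $C>0$ with $s\ge Cn^\kappa$ in each inequality. **Theorem.** Let $p\ge0$, let $\{T_n\}$ be an almost exponential sequence of tensors over $K$, and let $F\in\mathcal F$. Every $\hat\omega(p)$ obtained by an asymptotic mixed $\{T_n\}$-method satisfies $$\hat\omega(p)\ \ge\ \frac{\log_2F(\langle2,2,2^p\rangle)\,\log\tilde{\mathrm R}(\{T_n\})}{\log F(\{T_n\})},$$ and if the method is $\kappa$-catalytic, then $$\hat\omega(p)\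 \ge\ \frac{\log_2F(\langle2,2,2^p\rangle)\,\log\tilde{\mathrm R}(\{T_n\})}{\log F(\{T_n\})}+\kappa\left(\frac{\log\tilde{\mathrm R}(\{T_n\})}{\log F(\{T_n\})}-1\right).$$ (In the degenerate case $F(\{T_n\})=1$ the quotients are read as $0$.) -/

import Mathlib

open Filter Topology

namespace RectMM

noncomputable section

universe u

/-- A tensor of order three over `K`, written in coordinates: a trilinear form
`∑ coeff i j l * x_i * y_j * z_l` in three finite sets of variables. -/
structure Tensor (K : Type u) where
  I : Type
  J : Type
  L : Type
  [fI : Fintype I]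
  [fJ : Fintype J]
  [fL : Fintype L]
  [dI : DecidableEq I]
  [dJ : DecidableEq J]
  [dL : DecidableEq L]
  coeff : I → J → L → K

attribute [instance] Tensor.fI Tensor.fJ Tensor.fL Tensor.dI Tensor.dJ Tensor.dL

section Basic

variable {K : Type u} [Field K]

/-- The tensor `T ∘ (A, B, C)`, obtained by substituting linear forms for the variables of `T`:
`x_i := ∑ a, A i a * x'_a`, and similarly for the other two sets of variables. -/
def Tensor.subst (T : Tensor K) {I' J' L' : Type} [Fintype I'] [Fintype J'] [Fintype L']
    [DecidableEq I'] [DecidableEq J'] [DecidableEq L']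
    (A : Matrix T.I I' K) (B : Matrix T.J J' K) (C : Matrix T.L L' K) : Tensor K where
  I := I'
  J := J'
  L := L'
  coeff a b c := ∑ i, ∑ j, ∑ l, A i a * B j b * C l c * T.coeff i j l

/-- `S` is a restriction of `T`: `S = T ∘ (A, B, C)` for some linear maps `A, B, C`. -/
def Restricts (S T : Tensor K) : Prop :=
  ∃ (A : Matrix T.I S.I K) (B : Matrix T.J S.J K) (C : Matrix T.L S.L K),
    ∀ a b c, S.coeff a b c = (T.subst A B C).coeff a b c

/-- The diagonal (unit) tensor `⟨r⟩ = ∑ x_i y_i z_i`. -/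
def unitTensor (K : Type u) [Field K] (r : ℕ) : Tensor K where
  I := Fin r
  J := Fin r
  L := Fin r
  coeff i j l := if i = j ∧ j = l then 1 else 0

/-- The matrix multiplication tensor `⟨a, b, c⟩ = ∑ x_{ij} y_{jl} z_{li}`. -/
def mamu (K : Type u) [Field K] (a b c : ℕ) : Tensor K where
  I := Fin a × Fin b
  J := Fin b × Fin c
  L := Fin c × Fin a
  coeff x y z := if x.2 = y.1 ∧ y.2 = z.1 ∧ z.2 = x.1 then 1 else 0

/-- The tensor in no variables. -/
def emptyTensor (K : Type u) [Field K] : Tensor K := unitTensor K 0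

/-- The Kronecker product `S ⊗ T`. -/
def kron (S T : Tensor K) : Tensor K where
  I := S.I × T.I
  J := S.J × T.J
  L := S.L × T.L
  coeff x y z := S.coeff x.1 y.1 z.1 * T.coeff x.2 y.2 z.2

/-- The direct sum `S ⊕ T`. -/
def dsum (S T : Tensor K) : Tensor K where
  I := S.I ⊕ T.I
  J := S.J ⊕ T.J
  L := S.L ⊕ T.L
  coeff x y z :=
    match x, y, z with
    | Sum.inl i, Sum.inl j, Sum.inl l => S.coeff i j l
    | Sum.inr i, Sum.inr j, Sum.inr l => T.coeff i j l
    | _, _, _ => 0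

/-- The Kronecker power `T^{⊗ n}`. -/
def kronPow (T : Tensor K) : ℕ → Tensor K
  | 0 => unitTensor K 1
  | n + 1 => kron (kronPow T n) T

/-- The direct sum `T^{⊕ s}` of `s` copies of `T`. -/
def copies (T : Tensor K) : ℕ → Tensor K
  | 0 => emptyTensor K
  | s + 1 => dsum (copies T s) T

/-- The rank: the least `r` such that `T` is a restriction of `⟨r⟩`. -/
def rank (T : Tensor K) : ℕ := sInf {r : ℕ | Restricts T (unitTensor K r)}

/-- The asymptotic rank `lim R(T^{⊗ n})^{1/n}`. -/
def asympRank (T : Tensor K) : ℝ :=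
  limUnder atTop (fun n : ℕ => (rank (kronPow T n) : ℝ) ^ ((1 : ℝ) / n))

/-! ### Upper support functionals -/

/-- The Shannon entropy, in bits, of a probability vector. -/
def entropy {α : Type} [Fintype α] (P : α → ℝ) : ℝ :=
  (∑ a, Real.negMulLog (P a)) / Real.log 2

/-- The probability vectors on the support of `S`, as probability vectors on the full index set
that vanish off the support. -/
def suppDist (S : Tensor K) : Set (S.I × S.J × S.L → ℝ) :=
  {P | P ∈ stdSimplex ℝ (S.I × S.J × S.L) ∧ ∀ x, S.coeff x.1 x.2.1 x.2.2 = 0 → P x = 0}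

/-- `2 ^ (θ₁ H(P₁) + θ₂ H(P₂) + θ₃ H(P₃))` for the marginals `P₁, P₂, P₃` of `P`. -/
def expEntropy (θ : Fin 3 → ℝ) {I J L : Type} [Fintype I] [Fintype J] [Fintype L]
    (P : I × J × L → ℝ) : ℝ :=
  (2 : ℝ) ^ (θ 0 * entropy (fun i => ∑ j, ∑ l, P (i, j, l))
    + θ 1 * entropy (fun j => ∑ i, ∑ l, P (i, j, l))
    + θ 2 * entropy (fun l => ∑ i, ∑ j, P (i, j, l)))

/-- The maximum of `expEntropy θ` over the probability vectors on the support of `S`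
(it is `0` if `S` is the zero tensor). -/
def suppMax (θ : Fin 3 → ℝ) (S : Tensor K) : ℝ :=
  ⨆ P : suppDist S, expEntropy θ P.1

/-- The upper support functional `ζ^θ(T)`: the minimum of `suppMax θ S` over all tensors
`S = T ∘ (A, B, C)` with `A, B, C` invertible. -/
def upperSupport (θ : Fin 3 → ℝ) (T : Tensor K) : ℝ :=
  ⨅ g : GL T.I K × GL T.J K × GL T.L K,
    suppMax θ (T.subst (g.1 : Matrix T.I T.I K) (g.2.1 : Matrix T.J T.J K)
      (g.2.2 : Matrix T.L T.L K))

/-- `F` is one of the upper support functionals. -/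
def IsSupportFunctional (F : Tensor K → ℝ) : Prop :=
  ∃ θ ∈ stdSimplex ℝ (Fin 3), F = upperSupport θ

/-- The general properties of a map from tensors to nonnegative reals under which
the barriers hold. -/
structure HasBarrierProperties (F : Tensor K → ℝ) : Prop where
  nonneg : ∀ T, 0 ≤ F T
  normalised : F (unitTensor K 1) = 1
  monotone : ∀ S T, Restricts S T → F S ≤ F T
  submultiplicative : ∀ S T, F (kron S T) ≤ F S * F T
  mamu_multiplicative : ∀ a b c a' b' c' : ℕ,
    F (kron (mamu K a b c) (mamu K a' b' c')) = F (mamu K a b c) * F (mamu K a' b' c')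
  additive : ∀ S T, F (dsum S T) = F S + F T
  le_asympRank : ∀ T, F T ≤ asympRank T

/-- The maps `F` for which the barrier is stated: every upper support functional, and moreover
every map that has the properties in `HasBarrierProperties`. -/
def Admissible (F : Tensor K → ℝ) : Prop :=
  IsSupportFunctional F ∨ HasBarrierProperties F

open Classical in
/-- The value `F(⟨2, 2, 2^p⟩)` on the quasitensor `⟨2, 2, 2^p⟩`. If `p = log_a b` for integers
`a ≥ 2` and `b`, it is `2 ^ (log_a F(⟨a, a, b⟩))` (for the maps `F` at hand this does not depend
on the choice of `a`); otherwise it is the infimum of these values over all `P = log_a b ≥ p`. -/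
def quasi (F : Tensor K → ℝ) (p : ℝ) : ℝ :=
  if h : ∃ q : ℕ × ℕ, 2 ≤ q.1 ∧ (q.1 : ℝ) ^ p = q.2 then
    (2 : ℝ) ^ Real.logb h.choose.1 (F (mamu K h.choose.1 h.choose.1 h.choose.2))
  else
    ⨅ q : {q : ℕ × ℕ // 2 ≤ q.1 ∧ 1 ≤ q.2 ∧ p ≤ Real.logb q.1 q.2},
      (2 : ℝ) ^ Real.logb q.1.1 (F (mamu K q.1.1 q.1.1 q.1.2))

/-! ### Almost exponential sequences and asymptotic mixed methods -/

/-- `R̃(T_n)^{1/n}` converges and `F(T_n)^{1/n}` is bounded for each `F`. -/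
structure AlmostExponential (T : ℕ → Tensor K) : Prop where
  converges : ∃ ρ : ℝ, Tendsto (fun n : ℕ => asympRank (T n) ^ ((1 : ℝ) / n)) atTop (𝓝 ρ)
  bounded : ∀ F : Tensor K → ℝ, Admissible F →
    BddAbove (Set.range fun n : ℕ => F (T n) ^ ((1 : ℝ) / n))

/-- `R̃({T_n}) = lim R̃(T_n)^{1/n}`. -/
def seqAsympRank (T : ℕ → Tensor K) : ℝ :=
  limUnder atTop (fun n : ℕ => asympRank (T n) ^ ((1 : ℝ) / n))

/-- `F({T_n}) = limsup F(T_n)^{1/n}`. -/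
def seqValue (F : Tensor K → ℝ) (T : ℕ → Tensor K) : ℝ :=
  limsup (fun n : ℕ => F (T n) ^ ((1 : ℝ) / n)) atTop

end Basic

/-- The parameters of an inequality `⟨n, n, m⟩^{⊕ s} ≤ T_k`. -/
structure Ineq where
  n : ℕ
  m : ℕ
  s : ℕ
  k : ℕ

/-- The filter "`n → ∞`" on a collection of inequalities. -/
def nToInfty (C : Set Ineq) : Filter C := comap (fun x : C => x.1.n) atTop

/-- An asymptotic mixed `{T_n}`-method for `ω(p)`: a number `r ≥ R̃({T_n})` and a collection of
valid inequalities `⟨n, n, m⟩^{⊕ s} ≤ T_k`. -/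
structure MixedMethod {K : Type u} [Field K] (T : ℕ → Tensor K) (p : ℝ) where
  r : ℝ
  ineqs : Set Ineq
  seqAsympRank_le : seqAsympRank T ≤ r
  s_pos : ∀ x ∈ ineqs, 1 ≤ x.s
  restricts : ∀ x ∈ ineqs, Restricts (copies (mamu K x.n x.n x.m) x.s) (T x.k)
  /-- The values of `n` are unbounded. -/
  unbounded : ∀ N : ℕ, ∃ x ∈ ineqs, N ≤ x.n
  /-- `m ≥ f(n)` for some `f(n) = n ^ (p + o(1))`. -/
  growth : ∃ g : ℕ → ℝ, Tendsto g atTop (𝓝 0) ∧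
    ∀ x ∈ ineqs, (x.n : ℝ) ^ (p + g x.n) ≤ x.m
  /-- `R̃(T_k) ≤ r ^ k * n ^ o(1)` in the collection as `n → ∞`. It holds automatically if
  `r > R̃({T_n})`, and if `k = O(log n)`, and if `T_n = T^{⊗ n}`. -/
  rank_le : ∀ ε : ℝ, 0 < ε → ∀ᶠ x : ineqs in nToInfty ineqs,
    asympRank (T x.1.k) ≤ r ^ x.1.k * (x.1.n : ℝ) ^ ε

/-- The upper bound `ω̂(p) = lim inf {k log_n r - log_n s}` (as `n → ∞` in the collection)
obtained by the method, as an extended real number. -/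
def MixedMethod.omegaHat {K : Type u} [Field K] {T : ℕ → Tensor K} {p : ℝ}
    (M : MixedMethod T p) : EReal :=
  liminf (fun x : M.ineqs =>
    (((x.1.k : ℝ) * Real.logb x.1.n M.r - Real.logb x.1.n x.1.s : ℝ) : EReal))
    (nToInfty M.ineqs)

/-- The method is `κ`-catalytic: `s ≥ C n ^ κ` in each inequality, for a constant `C > 0`. -/
def MixedMethod.IsCatalytic {K : Type u} [Field K] {T : ℕ → Tensor K} {p : ℝ}
    (M : MixedMethod T p) (κ : ℝ) : Prop :=
  ∃ C : ℝ, 0 < C ∧ ∀ x ∈ M.ineqs, C * (x.n : ℝ) ^ κ ≤ x.s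

end

end RectMM

/-!
The argument compares two lower bounds that an inequality `⟨n, n, m⟩^{⊕ s} ≤ T_k` gives for `T_k`.

Every admissible `F` obeys a power law `F ⟨a, a, b⟩ = a ^ σ * b ^ γ` with `σ > 0` and `γ ≥ 0`, and
`⟨a, a, b⟩^{⊕ s} ≤ T` forces both `F T` and the asymptotic rank of `T` to be at least
`s * a ^ σ * b ^ γ` (`HasPowerLaw`, `Admissible.exists_hasPowerLaw`). Hence
`log₂ F ⟨2, 2, 2^p⟩ = σ + γ p =: v` (`HasPowerLaw.quasi_eq`), and in a method both `F T_k` and the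
asymptotic rank of `T_k` are at least `s * n ^ (v + o(1))`; in particular `k → ∞`.

* The bound on the asymptotic rank gives `k log_n r - log_n s ≥ v - o(1)`. This suffices when
  `log R̃({T_n}) / log F({T_n}) ≤ 1`, which includes the degenerate case `F({T_n}) = 1`.
* Otherwise take `y` between `log F({T_n})` and `log R̃({T_n})`. Then `F T_k ≤ exp (k y)` for large
  `k`, so `k y ≥ log s + (v + o(1)) log n`. Multiplying by `log R̃({T_n}) / y > 1` and subtracting
  `log s ≥ κ log n + O(1)` gives the claim as `y` decreases to `log F({T_n})`. The bound without
  `κ` is the case `κ = 0`.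

For a map with the barrier properties, the power law holds because a monotone completely
multiplicative function is a power function (`exists_eq_rpow_of_multiplicative`).

For an upper support functional, the maximum of the entropy over the distributions on the support
is first described by a dual certificate: sub-probability vectors `q₀, q₁, q₂` with
`V * q₀ ^ θ₀ * q₁ ^ θ₁ * q₂ ^ θ₂ ≥ 1` on the support (`Cover`, `cover_suppMax`,
`expEntropy_le_of_cover`). Certificates are carried along any substitution of variables by a column
echelon form in which the pivots are chosen of maximal weight (`exists_unitriangular_weight`,
`Cover.contract`). This yields monotonicity (`upperSupport_mono`). It also yields the exact value
`|I| ^ θ₀ * |J| ^ θ₁ * |L| ^ θ₂` on tight tensors that carry a distribution on the support with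
uniform marginals (`upperSupport_eq_card`): the support of a tight tensor is an antichain, so its
points survive unitriangular changes of basis, and the weighted inequality of arithmetic and
geometric means, averaged over the distribution, bounds `V`. These tensors are closed under
Kronecker products and include `⟨s⟩ ⊗ ⟨a, b, c⟩`, which is a restriction of `⟨a, b, c⟩^{⊕ s}`.
Applied to their Kronecker powers, the same value bounds the asymptotic rank
(`cardWeight_le_asympRank`); an upper support functional need not be supermultiplicative, so this
does not follow from a comparison of the functional with the asymptotic rank of `T` itself.
-/

namespace RectMM

/-! ### Restrictions of tensors -/

section Restriction

variable {K : Type*} [Field K]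

/-- Substitution of linear forms into a trilinear form, on the level of coefficient arrays. -/
def contract {I J L I' J' L' : Type} [Fintype I] [Fintype J] [Fintype L]
    (A : Matrix I I' K) (B : Matrix J J' K) (C : Matrix L L' K) (f : I → J → L → K) :
    I' → J' → L' → K :=
  fun a b c => ∑ i, ∑ j, ∑ l, A i a * B j b * C l c * f i j l

theorem contract_contract {I J L I' J' L' I'' J'' L'' : Type} [Fintype I] [Fintype J] [Fintype L]
    [Fintype I'] [Fintype J'] [Fintype L']
    (A : Matrix I I' K) (B : Matrix J J' K) (C : Matrix L L' K)
    (A' : Matrix I' I'' K) (B' : Matrix J' J'' K) (C' : Matrix L' L'' K) (f : I → J → L → K) :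
    contract A' B' C' (contract A B C f) = contract (A * A') (B * B') (C * C') f := by
  funext a b c
  have h1 : contract A' B' C' (contract A B C f) a b c
      = ∑ y : I' × J' × L', ∑ x : I × J × L,
        A' y.1 a * B' y.2.1 b * C' y.2.2 c *
          (A x.1 y.1 * B x.2.1 y.2.1 * C x.2.2 y.2.2 * f x.1 x.2.1 x.2.2) := by
    simp only [contract, Fintype.sum_prod_type, Finset.mul_sum]
  have h2 : contract (A * A') (B * B') (C * C') f a b c
      = ∑ x : I × J × L, ∑ y : I' × J' × L',
        A' y.1 a * B' y.2.1 b * C' y.2.2 c *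
          (A x.1 y.1 * B x.2.1 y.2.1 * C x.2.2 y.2.2 * f x.1 x.2.1 x.2.2) := by
    have h3 : ∀ (u : I' → K) (v : J' → K) (w : L' → K) (t : K),
        (∑ i, u i) * (∑ j, v j) * (∑ l, w l) * t = ∑ i, ∑ j, ∑ l, u i * v j * w l * t := by
      intro u v w t
      simp only [← Finset.sum_mul, ← Finset.mul_sum]
    simp only [contract, Fintype.sum_prod_type, Matrix.mul_apply, h3]
    refine Finset.sum_congr rfl fun i _ => Finset.sum_congr rfl fun j _ =>
      Finset.sum_congr rfl fun l _ => Finset.sum_congr rfl fun i' _ =>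
      Finset.sum_congr rfl fun j' _ => Finset.sum_congr rfl fun l' _ => ?_
    ring
  rw [h1, h2, Finset.sum_comm]

theorem contract_one {I J L : Type} [Fintype I] [Fintype J] [Fintype L] [DecidableEq I]
    [DecidableEq J] [DecidableEq L] (f : I → J → L → K) :
    contract (1 : Matrix I I K) (1 : Matrix J J K) (1 : Matrix L L K) f = f := by
  funext a b c
  simp [contract, Matrix.one_apply, ite_mul]

theorem contract_kron {I J L I' J' L' M N O M' N' O' : Type} [Fintype I] [Fintype J] [Fintype L]
    [Fintype M] [Fintype N] [Fintype O]
    (A : Matrix I I' K) (B : Matrix J J' K) (C : Matrix L L' K)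
    (A' : Matrix M M' K) (B' : Matrix N N' K) (C' : Matrix O O' K)
    (f : I → J → L → K) (g : M → N → O → K) (x : I' × M') (y : J' × N') (z : L' × O') :
    contract (fun (i : I × M) (a : I' × M') => A i.1 a.1 * A' i.2 a.2)
      (fun (i : J × N) (a : J' × N') => B i.1 a.1 * B' i.2 a.2)
      (fun (i : L × O) (a : L' × O') => C i.1 a.1 * C' i.2 a.2)
      (fun x y z => f x.1 y.1 z.1 * g x.2 y.2 z.2) x y z
      = contract A B C f x.1 y.1 z.1 * contract A' B' C' g x.2 y.2 z.2 := by
  simp only [contract, Fintype.sum_prod_type, Finset.sum_mul_sum]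
  refine Finset.sum_congr rfl fun i _ => Finset.sum_congr rfl fun j _ =>
      Finset.sum_congr rfl fun l _ => Finset.sum_congr rfl fun i' _ =>
      Finset.sum_congr rfl fun j' _ => Finset.sum_congr rfl fun l' _ => ?_
  ring

theorem restricts_iff {S T : Tensor K} : Restricts S T ↔
    ∃ (A : Matrix T.I S.I K) (B : Matrix T.J S.J K) (C : Matrix T.L S.L K),
      S.coeff = contract A B C T.coeff :=
  ⟨fun ⟨A, B, C, h⟩ => ⟨A, B, C, by funext a b c; exact h a b c⟩,
    fun ⟨A, B, C, h⟩ => ⟨A, B, C, fun a b c => by rw [h]; rfl⟩⟩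

theorem Restricts.trans {S T W : Tensor K} (h : Restricts S T) (h' : Restricts T W) :
    Restricts S W := by
  rw [restricts_iff] at *
  obtain ⟨A, B, C, h⟩ := h
  obtain ⟨A', B', C', h'⟩ := h'
  exact ⟨A' * A, B' * B, C' * C, by rw [h, h', contract_contract]⟩

/-- Identification and deletion of variables is a restriction. -/
theorem restricts_of_maps {S T : Tensor K} (φ : S.I → T.I) (ψ : S.J → T.J) (χ : S.L → T.L)
    (h : ∀ a b c, S.coeff a b c = T.coeff (φ a) (ψ b) (χ c)) : Restricts S T := by
  refine ⟨fun i a => if i = φ a then 1 else 0, fun i a => if i = ψ a then 1 else 0,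
    fun i a => if i = χ a then 1 else 0, fun a b c => ?_⟩
  rw [h]
  simp [Tensor.subst, ite_mul]

theorem Restricts.refl (T : Tensor K) : Restricts T T :=
  restricts_of_maps id id id fun _ _ _ => rfl

theorem Restricts.kron {S T S' T' : Tensor K} (h : Restricts S T) (h' : Restricts S' T') :
    Restricts (kron S S') (kron T T') := by
  rw [restricts_iff] at h h'
  obtain ⟨A, B, C, h⟩ := h
  obtain ⟨A', B', C', h'⟩ := h'
  refine ⟨fun i a => A i.1 a.1 * A' i.2 a.2, fun i a => B i.1 a.1 * B' i.2 a.2,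
    fun i a => C i.1 a.1 * C' i.2 a.2, fun a b c => ?_⟩
  have := contract_kron A B C A' B' C' T.coeff T'.coeff a b c
  rw [← h, ← h'] at this
  exact this.symm

theorem restricts_kron_unitTensor_one (T : Tensor K) : Restricts T (kron T (unitTensor K 1)) :=
  restricts_of_maps (fun i => (i, (0 : Fin 1))) (fun i => (i, (0 : Fin 1)))
    (fun i => (i, (0 : Fin 1))) fun a b c => by simp [RectMM.kron, unitTensor]

theorem Restricts.kronPow {S T : Tensor K} (h : Restricts S T) (n : ℕ) :
    Restricts (kronPow S n) (kronPow T n) := by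
  induction n with
  | zero => exact Restricts.refl _
  | succ n ih => exact ih.kron h

theorem restricts_kronPow_add (T : Tensor K) (m n : ℕ) :
    Restricts (RectMM.kronPow T (m + n)) (kron (RectMM.kronPow T m) (RectMM.kronPow T n)) := by
  induction n with
  | zero => exact restricts_kron_unitTensor_one _
  | succ n ih =>
    refine (ih.kron (Restricts.refl T)).trans ?_
    exact restricts_of_maps (fun x => (x.1.1, (x.1.2, x.2))) (fun x => (x.1.1, (x.1.2, x.2)))
      (fun x => (x.1.1, (x.1.2, x.2))) fun a b c => by simp [RectMM.kron, RectMM.kronPow, mul_assoc]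

theorem restricts_unitTensor_mul (r s : ℕ) :
    Restricts (kron (unitTensor K r) (unitTensor K s)) (unitTensor K (r * s)) := by
  refine restricts_of_maps (fun x => finProdFinEquiv x) (fun x => finProdFinEquiv x)
    (fun x => finProdFinEquiv x) fun (a b c : Fin r × Fin s) => ?_
  obtain ⟨a, a'⟩ := a
  obtain ⟨b, b'⟩ := b
  obtain ⟨c, c'⟩ := c
  change (if a = b ∧ b = c then (1 : K) else 0) * (if a' = b' ∧ b' = c' then 1 else 0) =
    if finProdFinEquiv (a, a') = finProdFinEquiv (b, b') ∧
      finProdFinEquiv (b, b') = finProdFinEquiv (c, c') then 1 else 0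
  simp only [EmbeddingLike.apply_eq_iff_eq, Prod.mk.injEq, ← ite_and, mul_ite, mul_one, mul_zero]
  exact if_congr (by tauto) rfl rfl

/-- Every tensor has finite rank. -/
theorem exists_restricts_unitTensor (T : Tensor K) : ∃ r, Restricts T (unitTensor K r) := by
  let e := (Fintype.equivFin (T.I × T.J × T.L)).symm
  refine ⟨Fintype.card (T.I × T.J × T.L), ?_⟩
  refine ⟨fun t a => if (e t).1 = a then 1 else 0, fun t b => if (e t).2.1 = b then 1 else 0,
    fun t c => if (e t).2.2 = c then T.coeff (e t).1 (e t).2.1 (e t).2.2 else 0,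
    fun a b c => ?_⟩
  have h1 : ∀ i : Fin (Fintype.card (T.I × T.J × T.L)), (∑ j, ∑ l,
      (if (e i).1 = a then (1 : K) else 0) * (if (e j).2.1 = b then 1 else 0) *
      (if (e l).2.2 = c then T.coeff (e l).1 (e l).2.1 (e l).2.2 else 0) *
        (if i = j ∧ j = l then 1 else 0)) = (if (e i).1 = a then (1 : K) else 0) *
      (if (e i).2.1 = b then 1 else 0) *
      (if (e i).2.2 = c then T.coeff (e i).1 (e i).2.1 (e i).2.2 else 0) := by
    intro i
    rw [Finset.sum_eq_single i, Finset.sum_eq_single i]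
    · simp
    · intro l _ hl; simp [Ne.symm hl]
    · simp
    · intro j _ hj
      exact Finset.sum_eq_zero fun l _ => by simp [Ne.symm hj]
    · simp
  change _ = ∑ i : Fin (Fintype.card (T.I × T.J × T.L)),
    ∑ j : Fin (Fintype.card (T.I × T.J × T.L)), ∑ l : Fin (Fintype.card (T.I × T.J × T.L)),
      (if (e i).1 = a then (1 : K) else 0) * (if (e j).2.1 = b then 1 else 0) *
      (if (e l).2.2 = c then T.coeff (e l).1 (e l).2.1 (e l).2.2 else 0) *
        (if i = j ∧ j = l then 1 else 0)
  rw [Finset.sum_congr rfl fun i _ => h1 i]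
  rw [Equiv.sum_comp e (fun x => (if x.1 = a then (1 : K) else 0) *
      (if x.2.1 = b then 1 else 0) * (if x.2.2 = c then T.coeff x.1 x.2.1 x.2.2 else 0))]
  simp [Fintype.sum_prod_type, ite_mul]

theorem restricts_unitTensor_rank (T : Tensor K) : Restricts T (unitTensor K (rank T)) :=
  Nat.sInf_mem (s := {r : ℕ | Restricts T (unitTensor K r)}) (exists_restricts_unitTensor T)

theorem rank_kronPow_add_le (T : Tensor K) (m n : ℕ) :
    rank (kronPow T (m + n)) ≤ rank (kronPow T m) * rank (kronPow T n) :=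
  Nat.sInf_le ((restricts_kronPow_add T m n).trans
    (((restricts_unitTensor_rank _).kron (restricts_unitTensor_rank _)).trans
      (restricts_unitTensor_mul _ _)))

theorem mamu_restricts_mamu {a b c a' b' c' : ℕ} (ha : a ≤ a') (hb : b ≤ b') (hc : c ≤ c') :
    Restricts (mamu K a b c) (mamu K a' b' c') :=
  restricts_of_maps (fun x => (Fin.castLE ha x.1, Fin.castLE hb x.2))
    (fun x => (Fin.castLE hb x.1, Fin.castLE hc x.2))
    (fun x => (Fin.castLE hc x.1, Fin.castLE ha x.2)) fun x y z => by simp [mamu]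

theorem kron_mamu_restricts (a b c a' b' c' : ℕ) :
    Restricts (kron (mamu K a b c) (mamu K a' b' c')) (mamu K (a * a') (b * b') (c * c')) := by
  refine restricts_of_maps
    (fun x => (finProdFinEquiv (x.1.1, x.2.1), finProdFinEquiv (x.1.2, x.2.2)))
    (fun x => (finProdFinEquiv (x.1.1, x.2.1), finProdFinEquiv (x.1.2, x.2.2)))
    (fun x => (finProdFinEquiv (x.1.1, x.2.1), finProdFinEquiv (x.1.2, x.2.2))) fun x y z => ?_
  simp only [RectMM.kron, mamu, EmbeddingLike.apply_eq_iff_eq, Prod.mk.injEq, ← ite_and, mul_ite,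
    mul_one, mul_zero]
  exact if_congr (by tauto) rfl rfl

theorem mamu_mul_restricts (a b c a' b' c' : ℕ) :
    Restricts (mamu K (a * a') (b * b') (c * c')) (kron (mamu K a b c) (mamu K a' b' c')) := by
  refine restricts_of_maps
    (fun x => (((finProdFinEquiv.symm x.1).1, (finProdFinEquiv.symm x.2).1),
      ((finProdFinEquiv.symm x.1).2, (finProdFinEquiv.symm x.2).2)))
    (fun x => (((finProdFinEquiv.symm x.1).1, (finProdFinEquiv.symm x.2).1),
      ((finProdFinEquiv.symm x.1).2, (finProdFinEquiv.symm x.2).2)))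
    (fun x => (((finProdFinEquiv.symm x.1).1, (finProdFinEquiv.symm x.2).1),
      ((finProdFinEquiv.symm x.1).2, (finProdFinEquiv.symm x.2).2))) fun x y z => ?_
  have key : ∀ {m n : ℕ} (u v : Fin (m * n)), u = v ↔
      (finProdFinEquiv.symm u).1 = (finProdFinEquiv.symm v).1 ∧
      (finProdFinEquiv.symm u).2 = (finProdFinEquiv.symm v).2 := fun u v => by
    rw [← Prod.ext_iff, EmbeddingLike.apply_eq_iff_eq]
  simp only [RectMM.kron, mamu, ← ite_and, mul_ite, mul_one, mul_zero]
  exact if_congr (by rw [key x.2, key y.2, key z.2]; tauto) rfl rfl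

theorem unitTensor_restricts_mamu {a b : ℕ} (hb : 1 ≤ b) :
    Restricts (unitTensor K a) (mamu K a a b) := by
  refine restricts_of_maps (fun i => (i, i)) (fun i => (i, (⟨0, hb⟩ : Fin b)))
    (fun i => ((⟨0, hb⟩ : Fin b), i)) fun (i j l : Fin a) => ?_
  change (if i = j ∧ j = l then (1 : K) else 0) =
    if i = j ∧ (⟨0, hb⟩ : Fin b) = ⟨0, hb⟩ ∧ l = i then 1 else 0
  exact if_congr ⟨fun h => ⟨h.1, rfl, by rw [h.1, h.2]⟩, fun h => ⟨h.1, by rw [← h.1, h.2.2]⟩⟩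
    rfl rfl

theorem unitTensor_one_restricts_mamu {a b c : ℕ} (ha : 1 ≤ a) (hb : 1 ≤ b) (hc : 1 ≤ c) :
    Restricts (unitTensor K 1) (mamu K a b c) :=
  (unitTensor_restricts_mamu le_rfl).trans (mamu_restricts_mamu ha hb hc)

theorem dsum_unitTensor_one_restricts (s : ℕ) :
    Restricts (dsum (unitTensor K s) (unitTensor K 1)) (unitTensor K (s + 1)) := by
  let φ : Fin s ⊕ Fin 1 → Fin (s + 1) := Sum.elim Fin.castSucc fun _ => Fin.last s
  refine restricts_of_maps φ φ φ fun (a b c : Fin s ⊕ Fin 1) => ?_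
  change _ = if φ a = φ b ∧ φ b = φ c then (1 : K) else 0
  rcases a with a | a <;> rcases b with b | b <;> rcases c with c | c <;>
    simp [dsum, unitTensor, φ, Fin.castSucc_ne_last, Ne.symm (Fin.castSucc_ne_last _),
      Subsingleton.elim _ (0 : Fin 1)]

/-- `s` copies of `T` contain the Kronecker product of `T` with the unit tensor `⟨s⟩`. -/
theorem kron_unitTensor_restricts_copies (T : Tensor K) (s : ℕ) :
    Restricts (kron (unitTensor K s) T) (copies T s) := by
  suffices h : ∃ (φ : Fin s → T.I → (copies T s).I) (ψ : Fin s → T.J → (copies T s).J)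
      (χ : Fin s → T.L → (copies T s).L), ∀ t t' t'' i j l,
      (copies T s).coeff (φ t i) (ψ t' j) (χ t'' l) =
        (if t = t' ∧ t' = t'' then 1 else 0) * T.coeff i j l by
    obtain ⟨φ, ψ, χ, h⟩ := h
    exact restricts_of_maps (fun x => φ x.1 x.2) (fun x => ψ x.1 x.2) (fun x => χ x.1 x.2)
      fun a b c => (h _ _ _ _ _ _).symm
  induction s with
  | zero => exact ⟨Fin.elim0, Fin.elim0, Fin.elim0, fun t => t.elim0⟩
  | succ s ih =>
    obtain ⟨φ, ψ, χ, h⟩ := ih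
    refine ⟨Fin.lastCases Sum.inr fun t i => Sum.inl (φ t i),
      Fin.lastCases Sum.inr fun t i => Sum.inl (ψ t i),
      Fin.lastCases Sum.inr fun t i => Sum.inl (χ t i), ?_⟩
    intro t t' t'' i j l
    refine Fin.lastCases ?_ (fun t => ?_) t <;> refine Fin.lastCases ?_ (fun t' => ?_) t' <;>
      refine Fin.lastCases ?_ (fun t'' => ?_) t'' <;>
      simp [copies, dsum, h, Fin.castSucc_ne_last, Ne.symm (Fin.castSucc_ne_last _)]

end Restriction

/-! ### Entropy and its dual description -/

section Entropy

/-- Gibbs' inequality, for a probability vector `p` and a sub-probability vector `q`. -/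
theorem sum_negMulLog_le {α : Type} [Fintype α] {p q : α → ℝ} (hp : ∀ a, 0 ≤ p a)
    (hq : ∀ a, 0 ≤ q a) (hp1 : ∑ a, p a = 1) (hq1 : ∑ a, q a ≤ 1)
    (h : ∀ a, q a = 0 → p a = 0) :
    ∑ a, Real.negMulLog (p a) ≤ ∑ a, p a * -Real.log (q a) := by
  have key : ∀ a, Real.negMulLog (p a) - p a * -Real.log (q a) ≤ q a - p a := by
    intro a
    rcases (hp a).eq_or_lt with h0 | h0
    · simpa [← h0] using hq a
    have hqa : 0 < q a := (hq a).lt_of_ne fun hh => h0.ne' (h a hh.symm)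
    have h1 := Real.log_le_sub_one_of_pos (div_pos hqa h0)
    rw [Real.log_div hqa.ne' h0.ne'] at h1
    have h2 := mul_le_mul_of_nonneg_left h1 h0.le
    have h3 : p a * (q a / p a - 1) = q a - p a := by field_simp
    rw [Real.negMulLog]
    linarith
  have := Finset.sum_le_sum fun a (_ : a ∈ Finset.univ) => key a
  rw [Finset.sum_sub_distrib, Finset.sum_sub_distrib] at this
  linarith

/-- The push-forward of a weight function along a map. -/
def marginal {X α : Type} [Fintype X] [DecidableEq α] (π : X → α) (P : X → ℝ) (a : α) : ℝ :=
  ∑ x, if π x = a then P x else 0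

section

variable {X α : Type} [Fintype X] [DecidableEq α] (π : X → α) {P : X → ℝ}

theorem sum_marginal_mul [Fintype α] (P : X → ℝ) (g : α → ℝ) :
    ∑ a, marginal π P a * g a = ∑ x, P x * g (π x) := by
  simp only [marginal, Finset.sum_mul]
  rw [Finset.sum_comm]
  simp [ite_mul]

theorem sum_marginal [Fintype α] (P : X → ℝ) : ∑ a, marginal π P a = ∑ x, P x := by
  simpa using sum_marginal_mul π P 1

theorem marginal_nonneg (hP : ∀ x, 0 ≤ P x) (a : α) : 0 ≤ marginal π P a :=
  Finset.sum_nonneg fun x _ => by split_ifs <;> simp [hP]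

theorem marginal_mix [DecidableEq X] (P : X → ℝ) (t : ℝ) (x : X) (a : α) :
    marginal π (fun y => (1 - t) * P y + t * if y = x then 1 else 0) a
      = (1 - t) * marginal π P a + t * if a = π x then 1 else 0 := by
  have h1 : ∀ y, (if π y = a then (1 - t) * P y + t * (if y = x then 1 else 0) else 0)
      = (1 - t) * (if π y = a then P y else 0)
        + if y = x then (if π y = a then t else 0) else 0 := by
    intro y
    split_ifs <;> simp
  simp only [marginal, h1, Finset.sum_add_distrib, ← Finset.mul_sum]
  simp [eq_comm]

/-- Moving a proportion `t` of the mass to one point changes the entropy by at least the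
amount that the tangent suggests. -/
theorem entropy_mix_ge [Fintype α] {p : α → ℝ} (hp : ∀ a, 0 ≤ p a) (hp1 : ∑ a, p a = 1) (b : α)
    {t : ℝ} (ht0 : 0 < t) (ht1 : t < 1) :
    (1 - t) * ∑ a, Real.negMulLog (p a) + t * -Real.log ((1 - t) * p b + t)
      ≤ ∑ a, Real.negMulLog ((1 - t) * p a + t * if a = b then 1 else 0) := by
  set q : α → ℝ := fun a => (1 - t) * p a + t * if a = b then 1 else 0 with hq
  have hq0 : ∀ a, 0 ≤ q a := fun a =>
    add_nonneg (mul_nonneg (by linarith) (hp a)) (mul_nonneg ht0.le (by split_ifs <;> norm_num))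
  have hq1 : ∑ a, q a = 1 := by
    simp [hq, Finset.sum_add_distrib, ← Finset.mul_sum, hp1]
  have hqp : ∀ a, q a = 0 → p a = 0 := by
    intro a ha
    have h1 : 0 ≤ t * (if a = b then (1 : ℝ) else 0) :=
      mul_nonneg ht0.le (by split_ifs <;> norm_num)
    have h2 : 0 ≤ (1 - t) * p a := mul_nonneg (by linarith) (hp a)
    have h3 : (1 - t) * p a = 0 := by simp only [hq] at ha; linarith
    rcases mul_eq_zero.1 h3 with h | h
    · linarith
    · exact h
  have hg := sum_negMulLog_le hp hq0 hp1 hq1.le hqp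
  have h2 : ∑ a, Real.negMulLog (q a)
      = (1 - t) * ∑ a, p a * -Real.log (q a) + t * -Real.log (q b) := by
    have : ∀ a, Real.negMulLog (q a)
        = (1 - t) * (p a * -Real.log (q a)) + if a = b then t * -Real.log (q a) else 0 := by
      intro a
      have hqa : q a = (1 - t) * p a + t * if a = b then 1 else 0 := rfl
      rw [Real.negMulLog]
      generalize Real.log (q a) = y
      rw [hqa]
      split_ifs <;> ring
    simp only [this, Finset.sum_add_distrib, ← Finset.mul_sum]
    simp
  have h3 : q b = (1 - t) * p b + t := by simp [hq]
  rw [← h3, h2]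
  have := mul_le_mul_of_nonneg_left hg (by linarith : 0 ≤ 1 - t)
  linarith

/-- Gibbs' inequality for a marginal, in a form that allows the exponent to vanish. -/
theorem mul_entropy_marginal_le [Fintype α] {θ : ℝ} (hθ : 0 ≤ θ) {q : α → ℝ} (hP : ∀ x, 0 ≤ P x)
    (hP1 : ∑ x, P x = 1) (hq : ∀ a, 0 ≤ q a) (hq1 : ∑ a, q a ≤ 1)
    (h : ∀ x, P x ≠ 0 → q (π x) ^ θ ≠ 0) :
    θ * ∑ a, Real.negMulLog (marginal π P a) ≤ ∑ x, P x * -Real.log (q (π x) ^ θ) := by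
  rcases hθ.eq_or_lt with rfl | hθ
  · simp
  have h0 : ∀ a, q a = 0 → marginal π P a = 0 := by
    intro a ha
    refine Finset.sum_eq_zero fun x _ => ?_
    split_ifs with hx
    · by_contra hPx
      exact h x hPx (by rw [hx, ha, Real.zero_rpow hθ.ne'])
    · rfl
  have h1 := sum_negMulLog_le (marginal_nonneg π hP) hq (by rw [sum_marginal, hP1]) hq1 h0
  rw [sum_marginal_mul π P fun a => -Real.log (q a)] at h1
  refine (mul_le_mul_of_nonneg_left h1 hθ.le).trans_eq ?_
  rw [Finset.mul_sum]
  refine Finset.sum_congr rfl fun x _ => ?_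
  by_cases hx : P x = 0
  · simp [hx]
  · have : q (π x) ≠ 0 := fun hh => h x hx (by rw [hh, Real.zero_rpow hθ.ne'])
    rw [Real.log_rpow ((hq _).lt_of_ne this.symm)]
    ring

end

theorem expEntropy_eq (θ : Fin 3 → ℝ) {I J L : Type} [Fintype I] [Fintype J] [Fintype L]
    [DecidableEq I] [DecidableEq J] [DecidableEq L] (P : I × J × L → ℝ) :
    expEntropy θ P = Real.exp (θ 0 * ∑ i, Real.negMulLog (marginal (fun x => x.1) P i)
      + θ 1 * ∑ i, Real.negMulLog (marginal (fun x => x.2.1) P i)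
      + θ 2 * ∑ i, Real.negMulLog (marginal (fun x => x.2.2) P i)) := by
  have h0 : (fun i => ∑ j, ∑ l, P (i, j, l)) = marginal (fun x => x.1) P := by
    funext a
    simp only [marginal, Fintype.sum_prod_type]
    rw [Finset.sum_eq_single a] <;> simp +contextual
  have h1 : (fun j => ∑ i, ∑ l, P (i, j, l)) = marginal (fun x => x.2.1) P := by
    funext a
    simp only [marginal, Fintype.sum_prod_type]
    refine Finset.sum_congr rfl fun i _ => ?_
    rw [Finset.sum_eq_single a] <;> simp +contextual
  have h2 : (fun l => ∑ i, ∑ j, P (i, j, l)) = marginal (fun x => x.2.2) P := by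
    funext a
    simp [marginal, Fintype.sum_prod_type]
  rw [expEntropy, h0, h1, h2, Real.rpow_def_of_pos two_pos]
  congr 1
  have := (Real.log_pos one_lt_two).ne'
  simp only [entropy]
  field_simp

end Entropy

section Cover

variable {K : Type*} [Field K]

/-- The dual certificate for `suppMax θ S ≤ V`: sub-probability vectors `q₀, q₁, q₂` on the three
index sets with `V * q₀ i ^ θ₀ * q₁ j ^ θ₁ * q₂ l ^ θ₂ ≥ 1` on the support. -/
def Cover (θ : Fin 3 → ℝ) {I J L : Type} [Fintype I] [Fintype J] [Fintype L]
    (f : I → J → L → K) (V : ℝ) : Prop :=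
  ∃ (q₀ : I → ℝ) (q₁ : J → ℝ) (q₂ : L → ℝ),
    ((∀ i, 0 ≤ q₀ i) ∧ ∑ i, q₀ i ≤ 1) ∧ ((∀ i, 0 ≤ q₁ i) ∧ ∑ i, q₁ i ≤ 1) ∧
    ((∀ i, 0 ≤ q₂ i) ∧ ∑ i, q₂ i ≤ 1) ∧
    ∀ i j l, f i j l ≠ 0 → 1 ≤ V * (q₀ i ^ θ 0 * q₁ j ^ θ 1 * q₂ l ^ θ 2)

variable {θ : Fin 3 → ℝ}

theorem expEntropy_le_of_cover (hθ : θ ∈ stdSimplex ℝ (Fin 3)) {S : Tensor K} {V : ℝ}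
    (h : Cover θ S.coeff V) {P : S.I × S.J × S.L → ℝ} (hP : P ∈ suppDist S) :
    expEntropy θ P ≤ V := by
  obtain ⟨q₀, q₁, q₂, ⟨h0, h0'⟩, ⟨h1, h1'⟩, ⟨h2, h2'⟩, h⟩ := h
  obtain ⟨⟨hP0, hP1⟩, hPs⟩ := hP
  have hb : ∀ x, P x ≠ 0 → 1 ≤ V * (q₀ x.1 ^ θ 0 * q₁ x.2.1 ^ θ 1 * q₂ x.2.2 ^ θ 2) :=
    fun x hx => h _ _ _ fun hh => hx (hPs x hh)
  have hne : ∀ x, P x ≠ 0 → V ≠ 0 ∧ q₀ x.1 ^ θ 0 ≠ 0 ∧ q₁ x.2.1 ^ θ 1 ≠ 0 ∧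
      q₂ x.2.2 ^ θ 2 ≠ 0 := by
    intro x hx
    have := hb x hx
    refine ⟨?_, ?_, ?_, ?_⟩ <;> intro hh <;> norm_num [hh] at this
  have hV : 0 < V := by
    obtain ⟨x, hx⟩ : ∃ x, P x ≠ 0 := by
      by_contra! hh
      simp [hh] at hP1
    have hpos : 0 ≤ q₀ x.1 ^ θ 0 * q₁ x.2.1 ^ θ 1 * q₂ x.2.2 ^ θ 2 := by
      have := h0 x.1; have := h1 x.2.1; have := h2 x.2.2
      positivity
    by_contra! hh
    linarith [hb x hx, mul_nonpos_of_nonpos_of_nonneg hh hpos]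
  rw [expEntropy_eq, ← Real.le_log_iff_exp_le hV]
  have e0 := mul_entropy_marginal_le (fun x : S.I × S.J × S.L => x.1) (hθ.1 0) hP0 hP1 h0 h0'
    fun x hx => (hne x hx).2.1
  have e1 := mul_entropy_marginal_le (fun x : S.I × S.J × S.L => x.2.1) (hθ.1 1) hP0 hP1 h1 h1'
    fun x hx => (hne x hx).2.2.1
  have e2 := mul_entropy_marginal_le (fun x : S.I × S.J × S.L => x.2.2) (hθ.1 2) hP0 hP1 h2 h2'
    fun x hx => (hne x hx).2.2.2
  refine (add_le_add (add_le_add e0 e1) e2).trans ?_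
  rw [← Finset.sum_add_distrib, ← Finset.sum_add_distrib]
  have : Real.log V = ∑ x, P x * Real.log V := by rw [← Finset.sum_mul, hP1, one_mul]
  rw [this]
  refine Finset.sum_le_sum fun x _ => ?_
  by_cases hx : P x = 0
  · simp [hx]
  obtain ⟨n0, n1, n2, n3⟩ := hne x hx
  have := Real.log_nonneg (hb x hx)
  rw [Real.log_mul n0 (by positivity), Real.log_mul (by positivity) n3, Real.log_mul n1 n2] at this
  rw [← mul_add, ← mul_add]
  exact mul_le_mul_of_nonneg_left (by linarith) (hP0 x)

theorem suppMax_le_of_cover (hθ : θ ∈ stdSimplex ℝ (Fin 3)) {S : Tensor K} {V : ℝ} (hV : 0 ≤ V)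
    (h : Cover θ S.coeff V) : suppMax θ S ≤ V :=
  Real.iSup_le (fun P => expEntropy_le_of_cover hθ h P.2) hV

theorem suppMax_nonneg (θ : Fin 3 → ℝ) (S : Tensor K) : 0 ≤ suppMax θ S :=
  Real.iSup_nonneg fun _ => Real.rpow_nonneg two_pos.le _

theorem continuous_expEntropy (θ : Fin 3 → ℝ) {I J L : Type} [Fintype I] [Fintype J] [Fintype L] :
    Continuous (expEntropy θ : (I × J × L → ℝ) → ℝ) := by
  unfold expEntropy entropy
  have := Real.continuous_negMulLog
  refine Continuous.rpow continuous_const (by fun_prop) fun _ => Or.inl two_ne_zero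

theorem isCompact_suppDist (S : Tensor K) : IsCompact (suppDist S) := by
  have : suppDist S = stdSimplex ℝ (S.I × S.J × S.L) ∩
      ⋂ x, {P | S.coeff x.1 x.2.1 x.2.2 = 0 → P x = 0} := by
    ext P; simp [suppDist]
  rw [this]
  refine (isCompact_stdSimplex ℝ _).inter_right (isClosed_iInter fun x => ?_)
  by_cases hx : S.coeff x.1 x.2.1 x.2.2 = 0
  · simp only [hx, forall_const]
    exact isClosed_eq (continuous_apply x) continuous_const
  · simp [hx]

/-- Strong duality: the marginals of a maximiser `P` certify the maximum. Moving a little mass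
of `P` to a point `x` of the support cannot increase the entropy, which bounds the
probabilities of the coordinates of `x` from below. -/
theorem cover_suppMax (hθ : θ ∈ stdSimplex ℝ (Fin 3)) (S : Tensor K) :
    Cover θ S.coeff (suppMax θ S) := by
  by_cases hS : ∀ i j l, S.coeff i j l = 0
  · exact ⟨0, 0, 0, by simp, by simp, by simp, fun i j l h => absurd (hS i j l) h⟩
  push Not at hS
  obtain ⟨i, j, l, hS⟩ := hS
  have hne : (suppDist S).Nonempty := by
    refine ⟨fun y => if y = (i, j, l) then 1 else 0, ⟨fun y => ?_, by simp⟩, fun y hy => ?_⟩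
    · dsimp only; split_ifs <;> norm_num
    · dsimp only
      split_ifs with h
      · subst h; exact absurd hy hS
      · rfl
  obtain ⟨P, hP, hmax⟩ := (isCompact_suppDist S).exists_isMaxOn hne
    (continuous_expEntropy θ).continuousOn
  have hle : expEntropy θ P ≤ suppMax θ S := by
    refine le_ciSup (f := fun P : suppDist S => expEntropy θ P.1) ?_ ⟨P, hP⟩
    refine ⟨expEntropy θ P, ?_⟩
    rintro _ ⟨Q, rfl⟩
    exact hmax Q.2
  obtain ⟨⟨hP0, hP1⟩, hPs⟩ := hP
  set m₀ := marginal (fun x : S.I × S.J × S.L => x.1) P with hm₀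
  set m₁ := marginal (fun x : S.I × S.J × S.L => x.2.1) P with hm₁
  set m₂ := marginal (fun x : S.I × S.J × S.L => x.2.2) P with hm₂
  have n0 : ∀ a, 0 ≤ m₀ a := marginal_nonneg _ hP0
  have n1 : ∀ a, 0 ≤ m₁ a := marginal_nonneg _ hP0
  have n2 : ∀ a, 0 ≤ m₂ a := marginal_nonneg _ hP0
  have s0 : ∑ a, m₀ a = 1 := by rw [hm₀, sum_marginal, hP1]
  have s1 : ∑ a, m₁ a = 1 := by rw [hm₁, sum_marginal, hP1]
  have s2 : ∑ a, m₂ a = 1 := by rw [hm₂, sum_marginal, hP1]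
  refine ⟨m₀, m₁, m₂, ⟨n0, s0.le⟩, ⟨n1, s1.le⟩, ⟨n2, s2.le⟩, fun i j l hx => ?_⟩
  have hθ0 := hθ.1 0
  have hθ1 := hθ.1 1
  have hθ2 := hθ.1 2
  have hprod : 0 ≤ m₀ i ^ θ 0 * m₁ j ^ θ 1 * m₂ l ^ θ 2 := by
    have := n0 i; have := n1 j; have := n2 l; positivity
  refine le_trans ?_ (mul_le_mul_of_nonneg_right hle hprod)
  have hE := expEntropy_eq θ P
  rw [← hm₀, ← hm₁, ← hm₂] at hE
  rw [hE]
  set E := θ 0 * ∑ i, Real.negMulLog (m₀ i) + θ 1 * ∑ i, Real.negMulLog (m₁ i)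
    + θ 2 * ∑ i, Real.negMulLog (m₂ i) with hEdef
  suffices h : Real.exp (-E) ≤ m₀ i ^ θ 0 * m₁ j ^ θ 1 * m₂ l ^ θ 2 by
    have := mul_le_mul_of_nonneg_left h (Real.exp_pos E).le
    rwa [← Real.exp_add, add_neg_cancel, Real.exp_zero] at this
  have hcont : Tendsto (fun t : ℝ => ((1 - t) * m₀ i + t) ^ θ 0 * ((1 - t) * m₁ j + t) ^ θ 1 *
      ((1 - t) * m₂ l + t) ^ θ 2) (𝓝[>] 0) (𝓝 (m₀ i ^ θ 0 * m₁ j ^ θ 1 * m₂ l ^ θ 2)) := by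
    have c0 := Real.continuous_rpow_const hθ0
    have c1 := Real.continuous_rpow_const hθ1
    have c2 := Real.continuous_rpow_const hθ2
    have hc : Continuous (fun t : ℝ => ((1 - t) * m₀ i + t) ^ θ 0 * ((1 - t) * m₁ j + t) ^ θ 1 *
      ((1 - t) * m₂ l + t) ^ θ 2) :=
      ((c0.comp (by fun_prop : Continuous fun t : ℝ => (1 - t) * m₀ i + t)).mul
        (c1.comp (by fun_prop : Continuous fun t : ℝ => (1 - t) * m₁ j + t))).mul
        (c2.comp (by fun_prop : Continuous fun t : ℝ => (1 - t) * m₂ l + t))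
    have := hc.tendsto 0
    simp only [sub_zero, one_mul, add_zero] at this
    exact this.mono_left nhdsWithin_le_nhds
  refine ge_of_tendsto hcont ?_
  filter_upwards [Ioo_mem_nhdsGT (zero_lt_one' ℝ)] with t ht
  obtain ⟨ht0, ht1⟩ := ht
  set Q : S.I × S.J × S.L → ℝ := fun y => (1 - t) * P y + t * if y = (i, j, l) then 1 else 0
    with hQ
  have hQs : Q ∈ suppDist S := by
    refine ⟨⟨fun y => ?_, ?_⟩, fun y hy => ?_⟩
    · exact add_nonneg (mul_nonneg (by linarith) (hP0 y))
        (mul_nonneg ht0.le (by split_ifs <;> norm_num))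
    · simp [hQ, Finset.sum_add_distrib, ← Finset.mul_sum, hP1]
    · have : y ≠ (i, j, l) := fun h => hx (by rw [h] at hy; exact hy)
      simp [hQ, hPs y hy, this]
  have hcmp : expEntropy θ Q ≤ expEntropy θ P := hmax hQs
  rw [expEntropy_eq, hE, Real.exp_le_exp] at hcmp
  have q0 : marginal (fun x : S.I × S.J × S.L => x.1) Q
      = fun a => (1 - t) * m₀ a + t * if a = i then 1 else 0 :=
    funext fun a => marginal_mix _ P t _ a
  have q1 : marginal (fun x : S.I × S.J × S.L => x.2.1) Q
      = fun a => (1 - t) * m₁ a + t * if a = j then 1 else 0 :=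
    funext fun a => marginal_mix _ P t _ a
  have q2 : marginal (fun x : S.I × S.J × S.L => x.2.2) Q
      = fun a => (1 - t) * m₂ a + t * if a = l then 1 else 0 :=
    funext fun a => marginal_mix _ P t _ a
  rw [q0, q1, q2] at hcmp
  have g0 := mul_le_mul_of_nonneg_left (entropy_mix_ge n0 s0 i ht0 ht1) hθ0
  have g1 := mul_le_mul_of_nonneg_left (entropy_mix_ge n1 s1 j ht0 ht1) hθ1
  have g2 := mul_le_mul_of_nonneg_left (entropy_mix_ge n2 s2 l ht0 ht1) hθ2
  have p0 : 0 < (1 - t) * m₀ i + t := by have := mul_nonneg (sub_nonneg.2 ht1.le) (n0 i); linarith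
  have p1 : 0 < (1 - t) * m₁ j + t := by have := mul_nonneg (sub_nonneg.2 ht1.le) (n1 j); linarith
  have p2 : 0 < (1 - t) * m₂ l + t := by have := mul_nonneg (sub_nonneg.2 ht1.le) (n2 l); linarith
  rw [Real.rpow_def_of_pos p0, Real.rpow_def_of_pos p1, Real.rpow_def_of_pos p2, ← Real.exp_add,
    ← Real.exp_add, Real.exp_le_exp]
  have hfin : (1 - t) * E + t * (-(Real.log ((1 - t) * m₀ i + t) * θ 0)
      - Real.log ((1 - t) * m₁ j + t) * θ 1 - Real.log ((1 - t) * m₂ l + t) * θ 2) ≤ E := by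
    refine le_trans (le_of_eq ?_) ((add_le_add (add_le_add g0 g1) g2).trans hcmp)
    rw [hEdef]; ring
  have : t * (-(Real.log ((1 - t) * m₀ i + t) * θ 0)
      - Real.log ((1 - t) * m₁ j + t) * θ 1 - Real.log ((1 - t) * m₂ l + t) * θ 2) ≤ t * E := by
    linarith
  have := le_of_mul_le_mul_left this ht0
  linarith

end Cover

/-! ### Triangular changes of basis -/

section Echelon

variable {K : Type*} [Field K]

/-- `U` is unitriangular for the order on the indices that is given by `τ`. -/
def IsUnitriangular {I Γ : Type} [LinearOrder Γ] (τ : I → Γ) (U : Matrix I I K) : Prop :=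
  (∀ a, U a a = 1) ∧ ∀ b a, U b a ≠ 0 → τ b ≤ τ a

theorem IsUnitriangular.isUnit {I Γ : Type} [Fintype I] [DecidableEq I] [LinearOrder Γ]
    {τ : I → Γ} (hτ : Function.Injective τ) {U : Matrix I I K} (hU : IsUnitriangular τ U) :
    IsUnit U := by
  classical
  rw [← Matrix.mulVec_injective_iff_isUnit]
  have hker : ∀ v : I → K, U.mulVec v = 0 → v = 0 := by
    intro v hv
    by_contra hne
    obtain ⟨i, hi⟩ := Function.ne_iff.1 hne
    obtain ⟨a, ha, hmax⟩ := Finset.exists_max_image (Finset.univ.filter fun i => v i ≠ 0) τ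
      ⟨i, by simpa using hi⟩
    have h1 : U.mulVec v a = v a := by
      rw [Matrix.mulVec, dotProduct, Finset.sum_eq_single a]
      · rw [hU.1, one_mul]
      · intro b _ hb
        by_contra h
        have h2 := hU.2 a b (left_ne_zero_of_mul h)
        have h3 := hmax b (by simpa using right_ne_zero_of_mul h)
        exact hb (hτ (le_antisymm h3 h2))
      · simp
    rw [hv] at h1
    exact (Finset.mem_filter.1 ha).2 h1.symm
  intro v w h
  have := hker (v - w) (by rw [Matrix.mulVec_sub]; exact sub_eq_zero.2 h)
  exact sub_eq_zero.1 this

/-- Weighted column echelon form. After a unitriangular change of basis on the columns of `A`,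
the nonzero columns have distinct pivots, where the pivot of a column is an element of its
support of maximal weight `q`. Assigning to each column the weight of its pivot does not increase
the total weight. The change of basis is found by making the support of each column minimal. -/
theorem exists_unitriangular_weight {I I' Γ : Type} [Fintype I] [Fintype I']
    [LinearOrder Γ] {τ : I' → Γ} (hτ : Function.Injective τ) (A : Matrix I I' K) {q : I → ℝ}
    (hq : ∀ i, 0 ≤ q i) :
    ∃ (U : Matrix I' I' K) (q' : I' → ℝ), IsUnitriangular τ U ∧ (∀ a, 0 ≤ q' a) ∧
      ∑ a, q' a ≤ ∑ i, q i ∧ ∀ i a, (A * U) i a ≠ 0 → q i ≤ q' a := by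
  classical
  let ρ : I → ℝ ×ₗ ℕ := fun i => toLex (q i, (Fintype.equivFin I i : ℕ))
  have hρ : Function.Injective ρ := by
    intro i j h
    have h1 := congrArg (fun x => (ofLex x).2) h
    exact (Fintype.equivFin I).injective (Fin.ext h1)
  have hρq : ∀ i j, ρ i ≤ ρ j → q i ≤ q j := by
    intro i j h
    rcases Prod.Lex.le_iff.1 h with h | h
    · exact h.le
    · exact h.1.le
  -- the down-set generated by the support of a vector
  let D : (I → K) → Finset I := fun v => Finset.univ.filter fun i => ∃ i', v i' ≠ 0 ∧ ρ i ≤ ρ i'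
  have hex : ∀ a, ∃ u : I' → K, (u a = 1 ∧ ∀ b, u b ≠ 0 → τ b ≤ τ a) ∧
      ∀ u' : I' → K, (u' a = 1 ∧ ∀ b, u' b ≠ 0 → τ b ≤ τ a) →
        (D (A.mulVec u)).card ≤ (D (A.mulVec u')).card := by
    intro a
    have hne : {u : I' → K | u a = 1 ∧ ∀ b, u b ≠ 0 → τ b ≤ τ a}.Nonempty := by
      refine ⟨Pi.single a 1, by simp, fun b hb => ?_⟩
      by_cases h : b = a
      · rw [h]
      · simp [h] at hb
    obtain ⟨u, hu, hmin⟩ := (measure fun u => (D (A.mulVec u)).card).wf.has_min _ hne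
    exact ⟨u, hu, fun u' hu' => not_lt.1 (hmin u' hu')⟩
  choose u hu hmin using hex
  let M : I' → I → K := fun a => A.mulVec (u a)
  let piv : I → I' → Prop := fun i a => M a i ≠ 0 ∧ ∀ i', M a i' ≠ 0 → ρ i' ≤ ρ i
  -- two columns with the same pivot: the later one could be improved with the earlier one
  have hlt : ∀ i a b, piv i a → piv i b → ¬ τ a < τ b := by
    intro i a b ha hb hab
    let c := M b i / M a i
    let u' : I' → K := fun x => u b x - c * u a x
    have hua : u a b = 0 := by
      by_contra h
      exact absurd ((hu a).2 b h) (not_le.2 hab)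
    have hu' : u' b = 1 ∧ ∀ x, u' x ≠ 0 → τ x ≤ τ b := by
      refine ⟨by simp [u', hua, (hu b).1], fun x hx => ?_⟩
      by_contra h
      have h1 : u b x = 0 := by by_contra h'; exact h ((hu b).2 x h')
      have h2 : u a x = 0 := by by_contra h'; exact h (((hu a).2 x h').trans hab.le)
      exact hx (by simp [u', h1, h2])
    have hM : ∀ x, A.mulVec u' x = M b x - c * M a x := by
      intro x
      have : u' = u b - c • u a := by funext y; simp [u']
      rw [this, Matrix.mulVec_sub, Matrix.mulVec_smul]
      simp [M]
    have hi : A.mulVec u' i = 0 := by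
      rw [hM, div_mul_cancel₀ _ ha.1, sub_self]
    have hle : ∀ x, A.mulVec u' x ≠ 0 → ρ x < ρ i := by
      intro x hx
      refine lt_of_le_of_ne ?_ fun h => hx (by rw [hρ h, hi])
      by_contra h
      have h1 : M b x = 0 := by by_contra h'; exact h (hb.2 x h')
      have h2 : M a x = 0 := by by_contra h'; exact h (ha.2 x h')
      exact hx (by rw [hM, h1, h2]; simp)
    have hss : D (A.mulVec u') ⊂ D (A.mulVec (u b)) := by
      refine Finset.ssubset_iff_of_subset ?_ |>.2 ⟨i, ?_, ?_⟩
      · intro x hx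
        obtain ⟨i', h1, h2⟩ := (Finset.mem_filter.1 hx).2
        exact Finset.mem_filter.2 ⟨Finset.mem_univ _, i, hb.1, h2.trans (hle i' h1).le⟩
      · exact Finset.mem_filter.2 ⟨Finset.mem_univ _, i, hb.1, le_rfl⟩
      · intro h
        obtain ⟨i', h1, h2⟩ := (Finset.mem_filter.1 h).2
        exact absurd h2 (not_le.2 (hle i' h1))
    exact absurd (hmin b u' hu') (not_le.2 (Finset.card_lt_card hss))
  have huniq : ∀ i a b, piv i a → piv i b → a = b := fun i a b ha hb =>
    hτ (le_antisymm (not_lt.1 (hlt i b a hb ha)) (not_lt.1 (hlt i a b ha hb)))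
  have hAU : ∀ i a, (A * Matrix.of fun b a => u a b) i a = M a i := by
    intro i a
    simp [Matrix.mul_apply, M, Matrix.mulVec, dotProduct]
  refine ⟨Matrix.of fun b a => u a b, fun a => ∑ i, if piv i a then q i else 0,
    ⟨fun a => (hu a).1, fun b a h => (hu a).2 b h⟩, fun a => ?_, ?_, fun i a h => ?_⟩
  · exact Finset.sum_nonneg fun i _ => by split_ifs <;> simp [hq]
  · rw [Finset.sum_comm]
    refine Finset.sum_le_sum fun i _ => ?_
    by_cases h : ∃ a, piv i a
    · obtain ⟨a, ha⟩ := h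
      rw [Finset.sum_eq_single a]
      · rw [if_pos ha]
      · intro b _ hb
        exact if_neg fun h => hb (huniq i b a h ha)
      · simp
    · push Not at h
      rw [Finset.sum_eq_zero fun a _ => if_neg (h a)]
      exact hq i
  · rw [hAU] at h
    obtain ⟨j, hj, hmax⟩ := Finset.exists_max_image (Finset.univ.filter fun i => M a i ≠ 0) ρ
      ⟨i, by simpa using h⟩
    have hp : piv j a := ⟨(Finset.mem_filter.1 hj).2, fun i' hi' => hmax i' (by simpa using hi')⟩
    refine (hρq i j (hp.2 i h)).trans ?_
    have := Finset.single_le_sum (f := fun i => if piv i a then q i else 0)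
      (fun i _ => by split_ifs <;> simp [hq]) (Finset.mem_univ j)
    simpa [hp] using this

end Echelon

section Monotone

variable {K : Type*} [Field K] {θ : Fin 3 → ℝ}

theorem exists_of_contract_ne_zero {I J L I' J' L' : Type} [Fintype I] [Fintype J] [Fintype L]
    {A : Matrix I I' K} {B : Matrix J J' K} {C : Matrix L L' K} {f : I → J → L → K}
    {a : I'} {b : J'} {c : L'} (h : contract A B C f a b c ≠ 0) :
    ∃ i j l, A i a ≠ 0 ∧ B j b ≠ 0 ∧ C l c ≠ 0 ∧ f i j l ≠ 0 := by
  obtain ⟨i, -, h⟩ := Finset.exists_ne_zero_of_sum_ne_zero h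
  obtain ⟨j, -, h⟩ := Finset.exists_ne_zero_of_sum_ne_zero h
  obtain ⟨l, -, h⟩ := Finset.exists_ne_zero_of_sum_ne_zero h
  refine ⟨i, j, l, ?_, ?_, ?_, ?_⟩ <;> intro hh <;> simp [hh] at h

/-- A dual certificate survives any substitution, up to unitriangular changes of basis for
prescribed orders of the new variables. -/
theorem Cover.contract {I J L I' J' L' Γ₀ Γ₁ Γ₂ : Type} [Fintype I] [Fintype J] [Fintype L]
    [Fintype I'] [Fintype J'] [Fintype L'] [LinearOrder Γ₀] [LinearOrder Γ₁] [LinearOrder Γ₂]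
    {α : I' → Γ₀} {β : J' → Γ₁} {γ : L' → Γ₂} (hα : Function.Injective α)
    (hβ : Function.Injective β) (hγ : Function.Injective γ) (hθ : ∀ i, 0 ≤ θ i)
    {f : I → J → L → K} {V : ℝ} (hV : 0 ≤ V) (h : Cover θ f V)
    (A : Matrix I I' K) (B : Matrix J J' K) (C : Matrix L L' K) :
    ∃ (A' : Matrix I' I' K) (B' : Matrix J' J' K) (C' : Matrix L' L' K),
      IsUnitriangular α A' ∧ IsUnitriangular β B' ∧ IsUnitriangular γ C' ∧
      Cover θ (contract A' B' C' (RectMM.contract A B C f)) V := by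
  obtain ⟨q₀, q₁, q₂, ⟨h0, h0'⟩, ⟨h1, h1'⟩, ⟨h2, h2'⟩, h⟩ := h
  obtain ⟨A', p₀, hA, n0, s0, g0⟩ := exists_unitriangular_weight hα A h0
  obtain ⟨B', p₁, hB, n1, s1, g1⟩ := exists_unitriangular_weight hβ B h1
  obtain ⟨C', p₂, hC, n2, s2, g2⟩ := exists_unitriangular_weight hγ C h2
  refine ⟨A', B', C', hA, hB, hC, p₀, p₁, p₂, ⟨n0, s0.trans h0'⟩, ⟨n1, s1.trans h1'⟩,
    ⟨n2, s2.trans h2'⟩, fun a b c hne => ?_⟩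
  rw [contract_contract] at hne
  obtain ⟨i, j, l, hi, hj, hl, hf⟩ := exists_of_contract_ne_zero hne
  refine (h i j l hf).trans (mul_le_mul_of_nonneg_left ?_ hV)
  have := h0 i; have := h1 j; have := h2 l; have := n0 a; have := n1 b; have := n2 c
  have r0 := Real.rpow_le_rpow (h0 i) (g0 i a hi) (hθ 0)
  have r1 := Real.rpow_le_rpow (h1 j) (g1 j b hj) (hθ 1)
  have r2 := Real.rpow_le_rpow (h2 l) (g2 l c hl) (hθ 2)
  gcongr

theorem upperSupport_le_suppMax (θ : Fin 3 → ℝ) (T : Tensor K)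
    (g : GL T.I K × GL T.J K × GL T.L K) :
    upperSupport θ T ≤ suppMax θ (T.subst (g.1 : Matrix T.I T.I K) (g.2.1 : Matrix T.J T.J K)
      (g.2.2 : Matrix T.L T.L K)) :=
  ciInf_le ⟨0, by rintro _ ⟨g, rfl⟩; exact suppMax_nonneg _ _⟩ g

theorem upperSupport_nonneg (θ : Fin 3 → ℝ) (T : Tensor K) : 0 ≤ upperSupport θ T :=
  Real.iInf_nonneg fun _ => suppMax_nonneg _ _

theorem upperSupport_le_of_cover (hθ : θ ∈ stdSimplex ℝ (Fin 3)) {T : Tensor K} {V : ℝ}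
    (hV : 0 ≤ V) (g : GL T.I K × GL T.J K × GL T.L K)
    (h : Cover θ (contract (g.1 : Matrix T.I T.I K) (g.2.1 : Matrix T.J T.J K)
      (g.2.2 : Matrix T.L T.L K) T.coeff) V) : upperSupport θ T ≤ V :=
  (upperSupport_le_suppMax θ T g).trans (suppMax_le_of_cover hθ hV h)

/-- Every lower bound that holds for the dual certificates of all tensors `T ∘ (A, B, C)` with
`A, B, C` invertible is a lower bound for the upper support functional. -/
theorem le_upperSupport_of_forall_cover (hθ : θ ∈ stdSimplex ℝ (Fin 3)) {T : Tensor K} {c : ℝ}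
    (h : ∀ (g : GL T.I K × GL T.J K × GL T.L K) (V : ℝ), 0 ≤ V →
      Cover θ (contract (g.1 : Matrix T.I T.I K) (g.2.1 : Matrix T.J T.J K)
        (g.2.2 : Matrix T.L T.L K) T.coeff) V → c ≤ V) : c ≤ upperSupport θ T :=
  le_ciInf fun g => h g _ (suppMax_nonneg _ _) (cover_suppMax hθ (T.subst _ _ _))

theorem contract_inv_contract {T : Tensor K} (g : GL T.I K × GL T.J K × GL T.L K) :
    contract ((g.1⁻¹ : GL T.I K) : Matrix T.I T.I K) ((g.2.1⁻¹ : GL T.J K) : Matrix T.J T.J K)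
      ((g.2.2⁻¹ : GL T.L K) : Matrix T.L T.L K)
      (contract (g.1 : Matrix T.I T.I K) (g.2.1 : Matrix T.J T.J K)
        (g.2.2 : Matrix T.L T.L K) T.coeff) = T.coeff := by
  rw [contract_contract]
  simp only [← Units.val_mul, mul_inv_cancel, Units.val_one, contract_one]

theorem upperSupport_mono (hθ : θ ∈ stdSimplex ℝ (Fin 3)) {S T : Tensor K}
    (h : Restricts S T) : upperSupport θ S ≤ upperSupport θ T := by
  obtain ⟨A, B, C, h⟩ := restricts_iff.1 h
  refine le_upperSupport_of_forall_cover hθ fun g V hV hc => ?_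
  have e0 := (Fintype.equivFin S.I).injective
  have e1 := (Fintype.equivFin S.J).injective
  have e2 := (Fintype.equivFin S.L).injective
  obtain ⟨A', B', C', hA, hB, hC, hc'⟩ := hc.contract e0 e1 e2 hθ.1 hV
    (((g.1⁻¹ : GL T.I K) : Matrix T.I T.I K) * A) (((g.2.1⁻¹ : GL T.J K) : Matrix T.J T.J K) * B)
    (((g.2.2⁻¹ : GL T.L K) : Matrix T.L T.L K) * C)
  rw [← contract_contract, contract_inv_contract, ← h] at hc'
  exact upperSupport_le_of_cover hθ hV
    ((hA.isUnit e0).unit, (hB.isUnit e1).unit, (hC.isUnit e2).unit) hc'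

theorem upperSupport_le_card (hθ : θ ∈ stdSimplex ℝ (Fin 3)) (T : Tensor K) :
    upperSupport θ T ≤ (Fintype.card T.I : ℝ) ^ θ 0 * (Fintype.card T.J : ℝ) ^ θ 1 *
      (Fintype.card T.L : ℝ) ^ θ 2 := by
  refine upperSupport_le_of_cover hθ (by positivity) 1 ?_
  have hs : ∀ α : Type, ∀ [Fintype α], (∀ _ : α, (0 : ℝ) ≤ (Fintype.card α : ℝ)⁻¹) ∧
      ∑ _ : α, (Fintype.card α : ℝ)⁻¹ ≤ 1 := by
    intro α _
    refine ⟨fun _ => by positivity, ?_⟩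
    rw [Finset.sum_const, Finset.card_univ, nsmul_eq_mul]
    exact mul_inv_le_one
  refine ⟨_, _, _, hs T.I, hs T.J, hs T.L, fun i j l _ => ?_⟩
  have h0 : (0 : ℝ) < Fintype.card T.I := by exact_mod_cast Fintype.card_pos_iff.2 ⟨i⟩
  have h1 : (0 : ℝ) < Fintype.card T.J := by exact_mod_cast Fintype.card_pos_iff.2 ⟨j⟩
  have h2 : (0 : ℝ) < Fintype.card T.L := by exact_mod_cast Fintype.card_pos_iff.2 ⟨l⟩
  rw [Real.inv_rpow h0.le, Real.inv_rpow h1.le, Real.inv_rpow h2.le]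
  have := Real.rpow_pos_of_pos h0 (θ 0)
  have := Real.rpow_pos_of_pos h1 (θ 1)
  have := Real.rpow_pos_of_pos h2 (θ 2)
  apply le_of_eq
  field_simp

end Monotone

/-! ### Tight tensors with a uniform distribution on the support -/

section Tight

variable {K : Type*} [Field K] {θ : Fin 3 → ℝ}

/-- A coefficient array is tight if its index sets embed into a linearly ordered abelian group in
such a way that the three indices of each point of the support sum to zero. -/
def IsTight {I J L : Type} (f : I → J → L → K) : Prop :=
  ∃ (Γ : Type) (_ : AddCommGroup Γ) (_ : LinearOrder Γ) (_ : IsOrderedAddMonoid Γ)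
    (α : I → Γ) (β : J → Γ) (γ : L → Γ), Function.Injective α ∧ Function.Injective β ∧
    Function.Injective γ ∧ ∀ i j l, f i j l ≠ 0 → α i + β j + γ l = 0

/-- A map `π` from a finite type is equidistributed if the image of the uniform distribution is
uniform; this is stated by testing against all functions. -/
def Equidistributed {D I : Type} [Fintype D] [Fintype I] (π : D → I) : Prop :=
  ∀ φ : I → ℝ, (Fintype.card I : ℝ) * ∑ d, φ (π d) = Fintype.card D * ∑ i, φ i

/-- There is a probability distribution on the support whose three marginals are uniform. It is
given by a finite family of points of the support. -/
def IsBalanced {I J L : Type} [Fintype I] [Fintype J] [Fintype L] (f : I → J → L → K) : Prop :=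
  ∃ (D : Type) (_ : Fintype D) (_ : Nonempty D) (x : D → I) (y : D → J) (z : D → L),
    Equidistributed x ∧ Equidistributed y ∧ Equidistributed z ∧ ∀ d, f (x d) (y d) (z d) ≠ 0

theorem IsTight.kron {I J L I' J' L' : Type} {f : I → J → L → K} {g : I' → J' → L' → K}
    (hf : IsTight f) (hg : IsTight g) :
    IsTight fun (x : I × I') (y : J × J') (z : L × L') => f x.1 y.1 z.1 * g x.2 y.2 z.2 := by
  obtain ⟨Γ, _, _, _, α, β, γ, hα, hβ, hγ, h⟩ := hf
  obtain ⟨Γ', _, _, _, α', β', γ', hα', hβ', hγ', h'⟩ := hg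
  refine ⟨Γ ×ₗ Γ', inferInstance, inferInstance, inferInstance, fun x => toLex (α x.1, α' x.2),
    fun x => toLex (β x.1, β' x.2), fun x => toLex (γ x.1, γ' x.2),
    fun x y hxy => Prod.ext (hα ?_) (hα' ?_), fun x y hxy => Prod.ext (hβ ?_) (hβ' ?_),
    fun x y hxy => Prod.ext (hγ ?_) (hγ' ?_), fun i j l hne => ?_⟩
  any_goals exact congrArg (fun x => (ofLex x).1) hxy
  any_goals exact congrArg (fun x => (ofLex x).2) hxy
  rw [← toLex_add, ← toLex_add, Prod.mk_add_mk, Prod.mk_add_mk, h _ _ _ (left_ne_zero_of_mul hne),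
    h' _ _ _ (right_ne_zero_of_mul hne)]
  rfl

theorem Equidistributed.prodMap {D I D' I' : Type} [Fintype D] [Fintype I] [Fintype D']
    [Fintype I'] {π : D → I} {π' : D' → I'} (h : Equidistributed π) (h' : Equidistributed π') :
    Equidistributed (Prod.map π π') := by
  intro φ
  simp only [Fintype.sum_prod_type, Fintype.card_prod, Nat.cast_mul, Prod.map_apply]
  have h1 := fun d => h' fun i' => φ (π d, i')
  have h2 := h fun i => ∑ i', φ (i, i')
  calc (Fintype.card I : ℝ) * Fintype.card I' * ∑ d, ∑ d', φ (π d, π' d')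
      = Fintype.card I * ∑ d, (Fintype.card I' * ∑ d', φ (π d, π' d')) := by
        rw [← Finset.mul_sum]; ring
    _ = Fintype.card D' * (Fintype.card I * ∑ d, ∑ i', φ (π d, i')) := by
        simp only [h1]; rw [← Finset.mul_sum]; ring
    _ = _ := by rw [h2]; ring

theorem IsBalanced.kron {I J L I' J' L' : Type} [Fintype I] [Fintype J] [Fintype L]
    [Fintype I'] [Fintype J'] [Fintype L'] {f : I → J → L → K} {g : I' → J' → L' → K}
    (hf : IsBalanced f) (hg : IsBalanced g) :
    IsBalanced fun (x : I × I') (y : J × J') (z : L × L') => f x.1 y.1 z.1 * g x.2 y.2 z.2 := by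
  obtain ⟨D, _, _, x, y, z, hx, hy, hz, h⟩ := hf
  obtain ⟨D', _, _, x', y', z', hx', hy', hz', h'⟩ := hg
  exact ⟨D × D', inferInstance, inferInstance, _, _, _, hx.prodMap hx', hy.prodMap hy',
    hz.prodMap hz', fun d => mul_ne_zero (h d.1) (h' d.2)⟩

/-- For a tight array, each point of the support survives a unitriangular change of basis with
respect to the orders given by the tightness, since the points of the support form an antichain. -/
theorem contract_unitriangular {I J L Γ : Type} [Fintype I] [Fintype J] [Fintype L]
    [AddCommGroup Γ] [LinearOrder Γ] [IsOrderedAddMonoid Γ] {f : I → J → L → K}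
    {α : I → Γ} {β : J → Γ} {γ : L → Γ} (hα : Function.Injective α) (hβ : Function.Injective β)
    (hγ : Function.Injective γ) (hf : ∀ i j l, f i j l ≠ 0 → α i + β j + γ l = 0)
    {A : Matrix I I K} {B : Matrix J J K} {C : Matrix L L K} (hA : IsUnitriangular α A)
    (hB : IsUnitriangular β B) (hC : IsUnitriangular γ C) {a : I} {b : J} {c : L}
    (h : f a b c ≠ 0) : contract A B C f a b c = f a b c := by
  have key : ∀ i j l, A i a * B j b * C l c * f i j l ≠ 0 → i = a ∧ j = b ∧ l = c := by
    intro i j l hne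
    have hf' := hf i j l (right_ne_zero_of_mul hne)
    have hC' := hC.2 l c (right_ne_zero_of_mul (left_ne_zero_of_mul hne))
    have hB' := hB.2 j b
      (right_ne_zero_of_mul (left_ne_zero_of_mul (left_ne_zero_of_mul hne)))
    have hA' := hA.2 i a
      (left_ne_zero_of_mul (left_ne_zero_of_mul (left_ne_zero_of_mul hne)))
    have hs : α i + β j + γ l = α a + β b + γ c := by rw [hf', hf a b c h]
    obtain ⟨h1, h2⟩ := (add_eq_add_iff_eq_and_eq (add_le_add hA' hB') hC').1 hs
    obtain ⟨h3, h4⟩ := (add_eq_add_iff_eq_and_eq hA' hB').1 h1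
    exact ⟨hα h3, hβ h4, hγ h2⟩
  have key' : ∀ i j l, ¬ (i = a ∧ j = b ∧ l = c) → A i a * B j b * C l c * f i j l = 0 :=
    fun i j l hn => by_contra fun hh => hn (key i j l hh)
  rw [contract, Finset.sum_eq_single a, Finset.sum_eq_single b, Finset.sum_eq_single c]
  · rw [hA.1, hB.1, hC.1]; ring
  · exact fun l _ hl => key' _ _ _ fun hh => hl hh.2.2
  · simp
  · exact fun j _ hj => Finset.sum_eq_zero fun l _ => key' _ _ _ fun hh => hj hh.2.1
  · simp
  · exact fun i _ hi => Finset.sum_eq_zero fun j _ => Finset.sum_eq_zero fun l _ =>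
      key' _ _ _ fun hh => hi hh.1
  · simp

/-- The upper support functional of a tight balanced tensor is as large as the number of
variables permits. -/
theorem upperSupport_eq_card (hθ : θ ∈ stdSimplex ℝ (Fin 3)) {T : Tensor K}
    (ht : IsTight T.coeff) (hb : IsBalanced T.coeff) :
    upperSupport θ T = (Fintype.card T.I : ℝ) ^ θ 0 * (Fintype.card T.J : ℝ) ^ θ 1 *
      (Fintype.card T.L : ℝ) ^ θ 2 := by
  refine le_antisymm (upperSupport_le_card hθ T)
    (le_upperSupport_of_forall_cover hθ fun g V hV hc => ?_)
  obtain ⟨Γ, _, _, _, α, β, γ, hα, hβ, hγ, hf⟩ := ht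
  obtain ⟨D, _, _, x, y, z, hx, hy, hz, hd⟩ := hb
  obtain ⟨A, B, C, hA, hB, hC, hc⟩ := hc.contract hα hβ hγ hθ.1 hV
    ((g.1⁻¹ : GL T.I K) : Matrix T.I T.I K) ((g.2.1⁻¹ : GL T.J K) : Matrix T.J T.J K)
    ((g.2.2⁻¹ : GL T.L K) : Matrix T.L T.L K)
  rw [contract_inv_contract] at hc
  obtain ⟨q₀, q₁, q₂, ⟨h0, h0'⟩, ⟨h1, h1'⟩, ⟨h2, h2'⟩, hc⟩ := hc
  set a : ℝ := ((Fintype.card T.I : ℕ) : ℝ) with ha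
  set b : ℝ := ((Fintype.card T.J : ℕ) : ℝ) with hb
  set c : ℝ := ((Fintype.card T.L : ℕ) : ℝ) with hc'
  have ha0 : 0 ≤ a := Nat.cast_nonneg _
  have hb0 : 0 ≤ b := Nat.cast_nonneg _
  have hc0 : 0 ≤ c := Nat.cast_nonneg _
  have hθ1 : θ 0 + θ 1 + θ 2 = 1 := by
    have := hθ.2
    rwa [Fin.sum_univ_three] at this
  have hpt : ∀ d, a ^ θ 0 * b ^ θ 1 * c ^ θ 2 ≤
      V * (θ 0 * (a * q₀ (x d)) + θ 1 * (b * q₁ (y d)) + θ 2 * (c * q₂ (z d))) := by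
    intro d
    have e1 := hc (x d) (y d) (z d)
      (by rw [contract_unitriangular hα hβ hγ hf hA hB hC (hd d)]; exact hd d)
    have e2 := Real.geom_mean_le_arith_mean3_weighted (hθ.1 0) (hθ.1 1) (hθ.1 2)
      (mul_nonneg ha0 (h0 (x d))) (mul_nonneg hb0 (h1 (y d))) (mul_nonneg hc0 (h2 (z d))) hθ1
    rw [Real.mul_rpow ha0 (h0 _), Real.mul_rpow hb0 (h1 _), Real.mul_rpow hc0 (h2 _)] at e2
    refine le_trans ?_ (mul_le_mul_of_nonneg_left e2 hV)
    have e3 := mul_le_mul_of_nonneg_left e1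
      (by positivity : 0 ≤ a ^ θ 0 * b ^ θ 1 * c ^ θ 2)
    rw [mul_one] at e3
    refine e3.trans (le_of_eq ?_)
    ring
  have hsum := Finset.sum_le_sum fun d (_ : d ∈ Finset.univ) => hpt d
  rw [Finset.sum_const, Finset.card_univ, nsmul_eq_mul, ← Finset.mul_sum, Finset.sum_add_distrib,
    Finset.sum_add_distrib, ← Finset.mul_sum, ← Finset.mul_sum, ← Finset.mul_sum,
    ← Finset.mul_sum, ← Finset.mul_sum, ← Finset.mul_sum, hx, hy, hz] at hsum
  have hD : (0 : ℝ) < Fintype.card D := by exact_mod_cast Fintype.card_pos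
  refine le_of_mul_le_mul_left (hsum.trans ?_) hD
  have f0 := mul_le_mul_of_nonneg_left h0' (hθ.1 0)
  have f1 := mul_le_mul_of_nonneg_left h1' (hθ.1 1)
  have f2 := mul_le_mul_of_nonneg_left h2' (hθ.1 2)
  have f3 : θ 0 * ∑ i, q₀ i + θ 1 * ∑ i, q₁ i + θ 2 * ∑ i, q₂ i ≤ 1 := by linarith
  calc _ = (Fintype.card D * V) * (θ 0 * ∑ i, q₀ i + θ 1 * ∑ i, q₁ i + θ 2 * ∑ i, q₂ i) := by ring
    _ ≤ (Fintype.card D * V) * 1 := mul_le_mul_of_nonneg_left f3 (by positivity)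
    _ = _ := mul_one _

theorem isTight_unitTensor (r : ℕ) : IsTight (unitTensor K r).coeff := by
  refine ⟨ℤ, inferInstance, inferInstance, inferInstance, fun i : Fin r => (i : ℤ),
    fun i : Fin r => (i : ℤ), fun i : Fin r => -2 * (i : ℤ), ?_, ?_, ?_, ?_⟩
  · intro i j h; exact Fin.ext (by simpa using h)
  · intro i j h; exact Fin.ext (by simpa using h)
  · intro i j h; exact Fin.ext (by simpa using h)
  · intro i j l h
    by_cases hh : i = j ∧ j = l
    · obtain ⟨rfl, rfl⟩ := hh
      ring
    · exact absurd (if_neg hh) h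

theorem isBalanced_unitTensor {r : ℕ} (hr : 1 ≤ r) : IsBalanced (unitTensor K r).coeff := by
  refine ⟨Fin r, inferInstance, ⟨⟨0, hr⟩⟩, id, id, id, fun φ => rfl, fun φ => rfl, fun φ => rfl,
    fun d => ?_⟩
  simp [unitTensor]

/-- The triple `(i, j, l)` gives the weights `i e₁ - j e₂`, `j e₂ - l e₃`, `l e₃ - i e₁`. -/
theorem isTight_mamu (a b c : ℕ) : IsTight (mamu K a b c).coeff := by
  refine ⟨ℤ ×ₗ (ℤ ×ₗ ℤ), inferInstance, inferInstance, inferInstance,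
    fun x : Fin a × Fin b => toLex ((x.1 : ℤ), toLex (-(x.2 : ℤ), 0)),
    fun x : Fin b × Fin c => toLex (0, toLex ((x.1 : ℤ), -(x.2 : ℤ))),
    fun x : Fin c × Fin a => toLex (-(x.2 : ℤ), toLex (0, (x.1 : ℤ))), ?_, ?_, ?_, ?_⟩
  · intro x y h
    have h1 := congrArg (fun u => (ofLex u).1) h
    have h2 := congrArg (fun u => (ofLex (ofLex u).2).1) h
    exact Prod.ext (Fin.ext (by simpa using h1)) (Fin.ext (by simpa using h2))
  · intro x y h
    have h1 := congrArg (fun u => (ofLex (ofLex u).2).1) h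
    have h2 := congrArg (fun u => (ofLex (ofLex u).2).2) h
    exact Prod.ext (Fin.ext (by simpa using h1)) (Fin.ext (by simpa using h2))
  · intro x y h
    have h1 := congrArg (fun u => (ofLex (ofLex u).2).2) h
    have h2 := congrArg (fun u => (ofLex u).1) h
    exact Prod.ext (Fin.ext (by simpa using h1)) (Fin.ext (by simpa using h2))
  · intro x y z h
    by_cases hh : x.2 = y.1 ∧ y.2 = z.1 ∧ z.2 = x.1
    · obtain ⟨h1, h2, h3⟩ := hh
      simp only [← toLex_add, Prod.mk_add_mk, h1, h2, h3]
      simp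
    · exact absurd (if_neg hh) h

theorem isBalanced_mamu {a b c : ℕ} (ha : 1 ≤ a) (hb : 1 ≤ b) (hc : 1 ≤ c) :
    IsBalanced (mamu K a b c).coeff := by
  refine ⟨Fin a × Fin b × Fin c, inferInstance, ⟨⟨⟨0, ha⟩, ⟨0, hb⟩, ⟨0, hc⟩⟩⟩,
    fun d => (d.1, d.2.1), fun d => (d.2.1, d.2.2), fun d => (d.2.2, d.1),
    fun φ : Fin a × Fin b → ℝ => ?_, fun φ : Fin b × Fin c → ℝ => ?_,
    fun φ : Fin c × Fin a → ℝ => ?_, fun d => ?_⟩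
  · change (Fintype.card (Fin a × Fin b) : ℝ) * ∑ d : Fin a × Fin b × Fin c, φ (d.1, d.2.1) =
      Fintype.card (Fin a × Fin b × Fin c) * ∑ i : Fin a × Fin b, φ i
    simp only [Fintype.sum_prod_type, Fintype.card_prod, Fintype.card_fin, Finset.sum_const,
      Finset.card_univ, nsmul_eq_mul, ← Finset.mul_sum, Nat.cast_mul]
    ring
  · change (Fintype.card (Fin b × Fin c) : ℝ) * ∑ d : Fin a × Fin b × Fin c, φ (d.2.1, d.2.2) =
      Fintype.card (Fin a × Fin b × Fin c) * ∑ i : Fin b × Fin c, φ i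
    simp only [Fintype.sum_prod_type, Fintype.card_prod, Fintype.card_fin, Finset.sum_const,
      Finset.card_univ, nsmul_eq_mul, Nat.cast_mul]
    ring
  · change (Fintype.card (Fin c × Fin a) : ℝ) * ∑ d : Fin a × Fin b × Fin c, φ (d.2.2, d.1) =
      Fintype.card (Fin a × Fin b × Fin c) * ∑ i : Fin c × Fin a, φ i
    simp only [Fintype.sum_prod_type, Fintype.card_prod, Fintype.card_fin, Finset.sum_const,
      Finset.card_univ, nsmul_eq_mul, ← Finset.mul_sum, Nat.cast_mul]
    rw [Finset.sum_comm]
    ring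
  · simp [mamu]

theorem isTight_kronPow {T : Tensor K} (h : IsTight T.coeff) (n : ℕ) :
    IsTight (kronPow T n).coeff := by
  induction n with
  | zero => exact isTight_unitTensor 1
  | succ n ih => exact ih.kron h

theorem isBalanced_kronPow {T : Tensor K} (h : IsBalanced T.coeff) (n : ℕ) :
    IsBalanced (kronPow T n).coeff := by
  induction n with
  | zero => exact isBalanced_unitTensor le_rfl
  | succ n ih => exact ih.kron h

end Tight

/-! ### Lower bounds for the asymptotic rank -/

section AsympRank

variable {K : Type*} [Field K] {θ : Fin 3 → ℝ}

/-- The product `|I| ^ θ₀ * |J| ^ θ₁ * |L| ^ θ₂` for a tensor with these index sets. -/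
noncomputable def cardWeight (θ : Fin 3 → ℝ) (T : Tensor K) : ℝ :=
  (Fintype.card T.I : ℝ) ^ θ 0 * (Fintype.card T.J : ℝ) ^ θ 1 * (Fintype.card T.L : ℝ) ^ θ 2

theorem cardWeight_unitTensor (hθ : θ ∈ stdSimplex ℝ (Fin 3)) (r : ℕ) :
    cardWeight θ (unitTensor K r) = r := by
  have hθ1 : θ 0 + θ 1 + θ 2 = 1 := by
    have := hθ.2
    rwa [Fin.sum_univ_three] at this
  change (Fintype.card (Fin r) : ℝ) ^ θ 0 * (Fintype.card (Fin r) : ℝ) ^ θ 1 *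
    (Fintype.card (Fin r) : ℝ) ^ θ 2 = r
  have hr : (0 : ℝ) ≤ r := Nat.cast_nonneg r
  rw [Fintype.card_fin, ← Real.rpow_add_of_nonneg hr (hθ.1 0) (hθ.1 1),
    ← Real.rpow_add_of_nonneg hr (add_nonneg (hθ.1 0) (hθ.1 1)) (hθ.1 2), hθ1, Real.rpow_one]

theorem cardWeight_kron (S T : Tensor K) :
    cardWeight θ (kron S T) = cardWeight θ S * cardWeight θ T := by
  change (Fintype.card (S.I × T.I) : ℝ) ^ θ 0 * (Fintype.card (S.J × T.J) : ℝ) ^ θ 1 *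
    (Fintype.card (S.L × T.L) : ℝ) ^ θ 2 = _
  simp only [Fintype.card_prod, Nat.cast_mul]
  rw [Real.mul_rpow (Nat.cast_nonneg _) (Nat.cast_nonneg _),
    Real.mul_rpow (Nat.cast_nonneg _) (Nat.cast_nonneg _),
    Real.mul_rpow (Nat.cast_nonneg _) (Nat.cast_nonneg _), cardWeight, cardWeight]
  ring

theorem cardWeight_kronPow (hθ : θ ∈ stdSimplex ℝ (Fin 3)) (T : Tensor K) (n : ℕ) :
    cardWeight θ (kronPow T n) = cardWeight θ T ^ n := by
  induction n with
  | zero => rw [pow_zero]; exact (cardWeight_unitTensor hθ 1).trans Nat.cast_one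
  | succ n ih => rw [pow_succ, ← ih]; exact cardWeight_kron _ _

theorem cardWeight_mamu (hθ : θ ∈ stdSimplex ℝ (Fin 3)) {a b : ℕ} (ha : 1 ≤ a) (hb : 1 ≤ b) :
    cardWeight θ (mamu K a a b) = (a : ℝ) ^ (1 + θ 0) * (b : ℝ) ^ (θ 1 + θ 2) := by
  have hθ1 : θ 0 + θ 1 + θ 2 = 1 := by
    have := hθ.2
    rwa [Fin.sum_univ_three] at this
  change (Fintype.card (Fin a × Fin a) : ℝ) ^ θ 0 * (Fintype.card (Fin a × Fin b) : ℝ) ^ θ 1 *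
    (Fintype.card (Fin b × Fin a) : ℝ) ^ θ 2 = _
  have ha' : (0 : ℝ) < a := by exact_mod_cast ha
  have hb' : (0 : ℝ) < b := by exact_mod_cast hb
  simp only [Fintype.card_prod, Fintype.card_fin, Nat.cast_mul]
  rw [Real.mul_rpow ha'.le ha'.le, Real.mul_rpow ha'.le hb'.le, Real.mul_rpow hb'.le ha'.le,
    ← hθ1, Real.rpow_add ha', Real.rpow_add ha', Real.rpow_add ha', Real.rpow_add hb']
  ring

/-- The limit in the definition of the asymptotic rank exists, by subadditivity of the logarithm
of the rank. -/
theorem tendsto_asympRank {T : Tensor K} (h : ∀ n, 1 ≤ rank (kronPow T n)) :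
    Tendsto (fun n : ℕ => (rank (kronPow T n) : ℝ) ^ ((1 : ℝ) / n)) atTop (𝓝 (asympRank T)) := by
  have hpos : ∀ n, (0 : ℝ) < rank (kronPow T n) := fun n => by exact_mod_cast h n
  have hsub : Subadditive fun n => Real.log (rank (kronPow T n)) := by
    intro m n
    rw [← Real.log_mul (hpos m).ne' (hpos n).ne']
    exact Real.log_le_log (hpos _) (by exact_mod_cast rank_kronPow_add_le T m n)
  have hlim := hsub.tendsto_lim ⟨0, by
    rintro _ ⟨n, rfl⟩
    exact div_nonneg (Real.log_nonneg (by exact_mod_cast h n)) (Nat.cast_nonneg n)⟩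
  have : Tendsto (fun n : ℕ => (rank (kronPow T n) : ℝ) ^ ((1 : ℝ) / n)) atTop
      (𝓝 (Real.exp hsub.lim)) := by
    refine ((Real.continuous_exp.tendsto _).comp hlim).congr fun n => ?_
    rw [Real.rpow_def_of_pos (hpos n), mul_one_div, Function.comp]
  exact tendsto_nhds_limUnder ⟨_, this⟩

/-- A tight balanced tensor `E` bounds the asymptotic rank of every tensor that it is a restriction
of, since its Kronecker powers remain tight and balanced. -/
theorem cardWeight_le_asympRank (hθ : θ ∈ stdSimplex ℝ (Fin 3)) {E T : Tensor K}
    (ht : IsTight E.coeff) (hb : IsBalanced E.coeff) (h : Restricts E T) :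
    cardWeight θ E ≤ asympRank T := by
  have hrank : ∀ n, cardWeight θ E ^ n ≤ rank (kronPow T n) := by
    intro n
    rw [← cardWeight_kronPow hθ, ← cardWeight_unitTensor (K := K) hθ (rank (kronPow T n)),
      cardWeight, ← upperSupport_eq_card hθ (isTight_kronPow ht n) (isBalanced_kronPow hb n)]
    exact (upperSupport_mono hθ ((h.kronPow n).trans (restricts_unitTensor_rank _))).trans
      (upperSupport_le_card hθ _)
  have hE : 0 < cardWeight θ E := by
    obtain ⟨D, _, ⟨d⟩, x, y, z, -⟩ := hb
    have h0 : (0 : ℝ) < Fintype.card E.I := by exact_mod_cast Fintype.card_pos_iff.2 ⟨x d⟩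
    have h1 : (0 : ℝ) < Fintype.card E.J := by exact_mod_cast Fintype.card_pos_iff.2 ⟨y d⟩
    have h2 : (0 : ℝ) < Fintype.card E.L := by exact_mod_cast Fintype.card_pos_iff.2 ⟨z d⟩
    unfold cardWeight
    positivity
  have hpos : ∀ n, 1 ≤ rank (kronPow T n) := fun n => by
    have := (pow_pos hE n).trans_le (hrank n)
    exact_mod_cast this
  refine ge_of_tendsto (tendsto_asympRank hpos) ?_
  filter_upwards [eventually_ge_atTop 1] with n hn
  have := Real.rpow_le_rpow (pow_pos hE n).le (hrank n) (by positivity : 0 ≤ (1 : ℝ) / n)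
  rw [one_div, Real.pow_rpow_inv_natCast hE.le (by omega)] at this
  rwa [one_div]

end AsympRank

/-! ### Values on matrix multiplication tensors -/

section Values

variable {K : Type*} [Field K]

/-- The properties of `F` that the barrier depends on: `F ⟨a, a, b⟩ = a ^ σ * b ^ γ`, and the
`s`-fold multiple of this value is a lower bound for both `F T` and the asymptotic rank of `T`
whenever `⟨a, a, b⟩^{⊕ s} ≤ T`. -/
structure HasPowerLaw (F : Tensor K → ℝ) (σ γ : ℝ) : Prop where
  nonneg : ∀ T, 0 ≤ F T
  σ_pos : 0 < σ
  γ_nonneg : 0 ≤ γ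
  mamu_eq : ∀ a b : ℕ, 1 ≤ a → 1 ≤ b → F (mamu K a a b) = (a : ℝ) ^ σ * (b : ℝ) ^ γ
  le_value : ∀ a b s : ℕ, 1 ≤ a → 1 ≤ b → 1 ≤ s → ∀ T, Restricts (copies (mamu K a a b) s) T →
    (s : ℝ) * ((a : ℝ) ^ σ * (b : ℝ) ^ γ) ≤ F T
  le_asympRank : ∀ a b s : ℕ, 1 ≤ a → 1 ≤ b → 1 ≤ s → ∀ T,
    Restricts (copies (mamu K a a b) s) T →
    (s : ℝ) * ((a : ℝ) ^ σ * (b : ℝ) ^ γ) ≤ asympRank T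

theorem hasPowerLaw_upperSupport {θ : Fin 3 → ℝ} (hθ : θ ∈ stdSimplex ℝ (Fin 3)) :
    HasPowerLaw (K := K) (upperSupport θ) (1 + θ 0) (θ 1 + θ 2) := by
  have hkron : ∀ a b s : ℕ, 1 ≤ a → 1 ≤ b → cardWeight θ (kron (unitTensor K s) (mamu K a a b))
      = (s : ℝ) * ((a : ℝ) ^ (1 + θ 0) * (b : ℝ) ^ (θ 1 + θ 2)) := fun a b s ha hb => by
    rw [cardWeight_kron, cardWeight_unitTensor hθ, cardWeight_mamu hθ ha hb]
  have htight : ∀ a b s : ℕ, IsTight (kron (unitTensor K s) (mamu K a a b)).coeff :=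
    fun a b s => (isTight_unitTensor s).kron (isTight_mamu a a b)
  have hbal : ∀ a b s : ℕ, 1 ≤ a → 1 ≤ b → 1 ≤ s →
      IsBalanced (kron (unitTensor K s) (mamu K a a b)).coeff :=
    fun a b s ha hb hs => (isBalanced_unitTensor hs).kron (isBalanced_mamu ha ha hb)
  refine ⟨upperSupport_nonneg θ, by linarith [hθ.1 0], add_nonneg (hθ.1 1) (hθ.1 2), ?_, ?_, ?_⟩
  · intro a b ha hb
    rw [upperSupport_eq_card hθ (isTight_mamu a a b) (isBalanced_mamu ha ha hb),
      ← cardWeight_mamu (K := K) hθ ha hb, cardWeight]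
  · intro a b s ha hb hs T hT
    rw [← hkron a b s ha hb, cardWeight,
      ← upperSupport_eq_card hθ (htight a b s) (hbal a b s ha hb hs)]
    exact upperSupport_mono hθ ((kron_unitTensor_restricts_copies _ s).trans hT)
  · intro a b s ha hb hs T hT
    rw [← hkron a b s ha hb]
    exact cardWeight_le_asympRank hθ (htight a b s) (hbal a b s ha hb hs)
      ((kron_unitTensor_restricts_copies _ s).trans hT)

/-- A monotone completely multiplicative function with values at least `1` is a power function. -/
theorem exists_eq_rpow_of_multiplicative {g : ℕ → ℝ} (h1 : ∀ n, 1 ≤ n → 1 ≤ g n)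
    (hmul : ∀ m n, g (m * n) = g m * g n) (hmono : ∀ m n, m ≤ n → g m ≤ g n) :
    ∃ γ : ℝ, 0 ≤ γ ∧ ∀ n : ℕ, 1 ≤ n → g n = (n : ℝ) ^ γ := by
  have hg1 : g 1 = 1 := by
    have := hmul 1 1
    have h := h1 1 le_rfl
    rw [mul_one] at this
    have : g 1 * (g 1 - 1) = 0 := by linarith
    rcases mul_eq_zero.1 this with h' | h' <;> linarith
  have hpow : ∀ n k, g (n ^ k) = g n ^ k := by
    intro n k
    induction k with
    | zero => simp [hg1]
    | succ k ih => rw [pow_succ, pow_succ, hmul, ih]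
  have hl2 : 0 < Real.log 2 := Real.log_pos one_lt_two
  have hy : 0 ≤ Real.log (g 2) := Real.log_nonneg (h1 2 one_le_two)
  have key : ∀ n : ℕ, 1 ≤ n → Real.log (g n) * Real.log 2 = Real.log (g 2) * Real.log n := by
    intro n hn
    have hgn : 0 < g n := one_pos.trans_le (h1 n hn)
    have hg2 : 0 < g 2 := one_pos.trans_le (h1 2 one_le_two)
    have hn0 : (0 : ℝ) < n := by exact_mod_cast hn
    have hb : ∀ k : ℕ, (k : ℝ) * |Real.log (g n) * Real.log 2 - Real.log (g 2) * Real.log n|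
        ≤ Real.log (g 2) * Real.log 2 := by
      intro k
      set j := Nat.log 2 (n ^ k) with hj
      have hlo : 2 ^ j ≤ n ^ k := Nat.pow_log_le_self 2 (pow_pos hn k).ne'
      have hhi : n ^ k ≤ 2 ^ (j + 1) := (Nat.lt_pow_succ_log_self one_lt_two _).le
      have a1 : (j : ℝ) * Real.log 2 ≤ k * Real.log n := by
        rw [← Real.log_pow, ← Real.log_pow]
        exact Real.log_le_log (by positivity) (by exact_mod_cast hlo)
      have a2 : (k : ℝ) * Real.log n ≤ (j + 1 : ℕ) * Real.log 2 := by
        rw [← Real.log_pow, ← Real.log_pow]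
        exact Real.log_le_log (by positivity) (by exact_mod_cast hhi)
      have a3 : (j : ℝ) * Real.log (g 2) ≤ k * Real.log (g n) := by
        rw [← Real.log_pow, ← Real.log_pow, ← hpow, ← hpow]
        exact Real.log_le_log (by rw [hpow]; positivity) (hmono _ _ hlo)
      have a4 : (k : ℝ) * Real.log (g n) ≤ (j + 1 : ℕ) * Real.log (g 2) := by
        rw [← Real.log_pow, ← Real.log_pow, ← hpow, ← hpow]
        exact Real.log_le_log (by rw [hpow]; positivity) (hmono _ _ hhi)
      push_cast at a2 a4
      have b1 := mul_le_mul_of_nonneg_left a1 hy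
      have b2 := mul_le_mul_of_nonneg_left a2 hy
      have b3 := mul_le_mul_of_nonneg_left a3 hl2.le
      have b4 := mul_le_mul_of_nonneg_left a4 hl2.le
      rw [← Nat.abs_cast k, ← abs_mul, abs_le]
      constructor <;> linarith
    by_contra hne
    have hd := abs_pos.2 (sub_ne_zero.2 hne)
    obtain ⟨k, hk⟩ := exists_nat_gt (Real.log (g 2) * Real.log 2 /
      |Real.log (g n) * Real.log 2 - Real.log (g 2) * Real.log n|)
    rw [div_lt_iff₀ hd] at hk
    exact absurd (hb k) (not_le.2 hk)
  refine ⟨Real.log (g 2) / Real.log 2, div_nonneg hy hl2.le, fun n hn => ?_⟩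
  have hn0 : (0 : ℝ) < n := by exact_mod_cast hn
  rw [Real.rpow_def_of_pos hn0, mul_div_assoc', mul_comm (Real.log n), ← key n hn,
    mul_div_cancel_right₀ _ hl2.ne', Real.exp_log (one_pos.trans_le (h1 n hn))]

theorem HasBarrierProperties.mul_le_of_copies_restricts {F : Tensor K → ℝ}
    (hF : HasBarrierProperties F) {S T : Tensor K} {s : ℕ} (h : Restricts (copies S s) T) :
    s * F S ≤ F T := by
  refine le_trans ?_ (hF.monotone _ _ h)
  clear h
  induction s with
  | zero => simpa using hF.nonneg _
  | succ s ih =>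
    rw [copies, hF.additive]
    push_cast
    linarith

theorem HasBarrierProperties.le_unitTensor {F : Tensor K → ℝ} (hF : HasBarrierProperties F)
    (r : ℕ) : (r : ℝ) ≤ F (unitTensor K r) := by
  induction r with
  | zero => simpa using hF.nonneg _
  | succ r ih =>
    refine le_trans ?_ (hF.monotone _ _ (dsum_unitTensor_one_restricts r))
    rw [hF.additive, hF.normalised]
    push_cast
    linarith

theorem HasBarrierProperties.mamu_mul {F : Tensor K → ℝ} (hF : HasBarrierProperties F)
    (a b c a' b' c' : ℕ) :
    F (mamu K (a * a') (b * b') (c * c')) = F (mamu K a b c) * F (mamu K a' b' c') := by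
  rw [← hF.mamu_multiplicative]
  exact le_antisymm (hF.monotone _ _ (mamu_mul_restricts ..))
    (hF.monotone _ _ (kron_mamu_restricts ..))

theorem HasBarrierProperties.exists_hasPowerLaw {F : Tensor K → ℝ} (hF : HasBarrierProperties F) :
    ∃ σ γ, HasPowerLaw F σ γ := by
  have hone : ∀ a b c : ℕ, 1 ≤ a → 1 ≤ b → 1 ≤ c → 1 ≤ F (mamu K a b c) := fun a b c ha hb hc => by
    rw [← hF.normalised]
    exact hF.monotone _ _ (unitTensor_one_restricts_mamu ha hb hc)
  obtain ⟨σ, -, hσ⟩ := exists_eq_rpow_of_multiplicative (g := fun a => F (mamu K a a 1))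
    (fun n hn => hone _ _ _ hn hn le_rfl) (fun m n => by simpa using hF.mamu_mul m m 1 n n 1)
    fun m n h => hF.monotone _ _ (mamu_restricts_mamu h h le_rfl)
  obtain ⟨γ, hγ0, hγ⟩ := exists_eq_rpow_of_multiplicative (g := fun b => F (mamu K 1 1 b))
    (fun n hn => hone _ _ _ le_rfl le_rfl hn) (fun m n => by simpa using hF.mamu_mul 1 1 m 1 1 n)
    fun m n h => hF.monotone _ _ (mamu_restricts_mamu le_rfl le_rfl h)
  have hval : ∀ a b : ℕ, 1 ≤ a → 1 ≤ b → F (mamu K a a b) = (a : ℝ) ^ σ * (b : ℝ) ^ γ :=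
    fun a b ha hb => by
      rw [← hσ a ha, ← hγ b hb, ← hF.mamu_mul]
      simp
  have hσ0 : 0 < σ := by
    have h2 : (2 : ℝ) ≤ 2 ^ σ := by
      have := (hF.le_unitTensor 2).trans
        (hF.monotone _ _ (unitTensor_restricts_mamu (K := K) (a := 2) le_rfl))
      have h3 := hσ 2 one_le_two
      push_cast at this h3
      rwa [h3] at this
    by_contra! hle
    have := Real.rpow_le_one_of_one_le_of_nonpos one_le_two hle
    linarith
  refine ⟨σ, γ, hF.nonneg, hσ0, hγ0, hval, ?_, ?_⟩
  · intro a b s ha hb _ T hT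
    rw [← hval a b ha hb]
    exact hF.mul_le_of_copies_restricts hT
  · intro a b s ha hb _ T hT
    rw [← hval a b ha hb]
    exact (hF.mul_le_of_copies_restricts hT).trans (hF.le_asympRank T)

theorem Admissible.exists_hasPowerLaw {F : Tensor K → ℝ} (hF : Admissible F) :
    ∃ σ γ, HasPowerLaw F σ γ := by
  rcases hF with ⟨θ, hθ, rfl⟩ | hF
  · exact ⟨_, _, hasPowerLaw_upperSupport hθ⟩
  · exact hF.exists_hasPowerLaw

end Values

/-! ### The barrier -/

section Barrier

variable {K : Type*} [Field K] {F : Tensor K → ℝ} {σ γ : ℝ}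

theorem HasPowerLaw.logb_mamu (hF : HasPowerLaw F σ γ) {a b : ℕ} (ha : 2 ≤ a) (hb : 1 ≤ b) :
    Real.logb a (F (mamu K a a b)) = σ + γ * Real.logb a b := by
  have ha' : (1 : ℝ) < a := by exact_mod_cast ha
  have hb' : (0 : ℝ) < b := by exact_mod_cast hb
  rw [hF.mamu_eq a b (by omega) hb, Real.logb_mul (by positivity) (by positivity),
    Real.logb_rpow (by positivity) ha'.ne', Real.logb_rpow_eq_mul_logb_of_pos hb']

theorem HasPowerLaw.quasi_eq (hF : HasPowerLaw F σ γ) {p : ℝ} (hp : 0 ≤ p) :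
    quasi F p = (2 : ℝ) ^ (σ + γ * p) := by
  unfold quasi
  split_ifs with h
  · obtain ⟨h1, h2⟩ := h.choose_spec
    have ha : (1 : ℝ) < h.choose.1 := by exact_mod_cast h1
    have hb : 1 ≤ h.choose.2 := by
      have : (0 : ℝ) < h.choose.2 := by rw [← h2]; positivity
      exact_mod_cast this
    rw [hF.logb_mamu h1 hb, ← h2, Real.logb_rpow (by positivity) ha.ne']
  · -- the pair `(a, ⌈a ^ p⌉)` has `p ≤ log_a ⌈a ^ p⌉ ≤ p + log_a 2`
    have hmem : ∀ n : ℕ, 2 ≤ n + 2 ∧ 1 ≤ ⌈((n + 2 : ℕ) : ℝ) ^ p⌉₊ ∧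
        p ≤ Real.logb (n + 2 : ℕ) ⌈((n + 2 : ℕ) : ℝ) ^ p⌉₊ := by
      intro n
      have hn : (1 : ℝ) < (n + 2 : ℕ) := by push_cast; linarith [Nat.cast_nonneg (α := ℝ) n]
      have hpos : (0 : ℝ) < ((n + 2 : ℕ) : ℝ) ^ p := by positivity
      refine ⟨by omega, Nat.one_le_iff_ne_zero.2 (Nat.ceil_pos.2 hpos).ne', ?_⟩
      rw [Real.le_logb_iff_rpow_le hn (by exact_mod_cast Nat.ceil_pos.2 hpos)]
      exact Nat.le_ceil _
    have hmem' : ∀ q : {q : ℕ × ℕ // 2 ≤ q.1 ∧ 1 ≤ q.2 ∧ p ≤ Real.logb q.1 q.2},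
        (2 : ℝ) ^ Real.logb q.1.1 (F (mamu K q.1.1 q.1.1 q.1.2))
          = (2 : ℝ) ^ (σ + γ * Real.logb q.1.1 q.1.2) := fun q => by
      rw [hF.logb_mamu q.2.1 q.2.2.1]
    simp only [hmem']
    apply le_antisymm
    · have hlog : Tendsto (fun n : ℕ => Real.log ((n + 2 : ℕ) : ℝ)) atTop atTop :=
        Real.tendsto_log_atTop.comp
          (tendsto_natCast_atTop_atTop.comp (tendsto_add_atTop_nat 2))
      have hlim : Tendsto (fun n : ℕ => (2 : ℝ) ^ (σ + γ * (p + Real.log 2 / Real.log (n + 2 : ℕ))))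
          atTop (𝓝 ((2 : ℝ) ^ (σ + γ * (p + 0)))) :=
        ((Real.continuous_const_rpow two_ne_zero).tendsto _).comp
          ((((hlog.const_div_atTop _).const_add p).const_mul γ).const_add σ)
      rw [add_zero] at hlim
      refine ge_of_tendsto' hlim fun n => ?_
      have hn : (1 : ℝ) < (n + 2 : ℕ) := by push_cast; linarith [Nat.cast_nonneg (α := ℝ) n]
      have h1 : (1 : ℝ) ≤ ((n + 2 : ℕ) : ℝ) ^ p := Real.one_le_rpow hn.le hp
      have hle : Real.logb (n + 2 : ℕ) ⌈((n + 2 : ℕ) : ℝ) ^ p⌉₊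
          ≤ p + Real.log 2 / Real.log (n + 2 : ℕ) := by
        have h2 : (⌈((n + 2 : ℕ) : ℝ) ^ p⌉₊ : ℝ) ≤ ((n + 2 : ℕ) : ℝ) ^ p * 2 := by
          have := Nat.ceil_lt_add_one (by positivity : (0 : ℝ) ≤ ((n + 2 : ℕ) : ℝ) ^ p)
          linarith
        have h3 := Real.logb_le_logb_of_le hn (by exact_mod_cast (hmem n).2.1) h2
        rwa [Real.logb_mul (by positivity) two_ne_zero, Real.logb_rpow (by positivity) hn.ne'] at h3
      refine (ciInf_le ⟨0, ?_⟩ ⟨(n + 2, ⌈((n + 2 : ℕ) : ℝ) ^ p⌉₊), hmem n⟩).trans ?_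
      · rintro _ ⟨q, rfl⟩
        dsimp only
        positivity
      · refine Real.rpow_le_rpow_of_exponent_le one_le_two ?_
        have := mul_le_mul_of_nonneg_left hle hF.γ_nonneg
        dsimp only
        linarith
    · have : Nonempty {q : ℕ × ℕ // 2 ≤ q.1 ∧ 1 ≤ q.2 ∧ p ≤ Real.logb q.1 q.2} :=
        ⟨⟨(0 + 2, ⌈((0 + 2 : ℕ) : ℝ) ^ p⌉₊), hmem 0⟩⟩
      refine le_ciInf fun q => Real.rpow_le_rpow_of_exponent_le one_le_two ?_
      have := mul_le_mul_of_nonneg_left q.2.2.2 hF.γ_nonneg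
      linarith

variable {T : ℕ → Tensor K} {p : ℝ}

theorem MixedMethod.tendsto_n (M : MixedMethod T p) :
    Tendsto (fun x : M.ineqs => x.1.n) (nToInfty M.ineqs) atTop := tendsto_comap

theorem MixedMethod.neBot (M : MixedMethod T p) : (nToInfty M.ineqs).NeBot := by
  refine comap_neBot fun t ht => ?_
  obtain ⟨N, hN⟩ := mem_atTop_sets.1 ht
  obtain ⟨x, hx, hn⟩ := M.unbounded N
  exact ⟨⟨x, hx⟩, hN _ hn⟩

/-- The inequalities of a method, read through `F` and through the asymptotic rank: both `F T_k` and
the asymptotic rank of `T_k` are at least `s * n ^ (v + o(1))`, with `v = log₂ F ⟨2, 2, 2^p⟩`. -/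
theorem MixedMethod.exists_lower_bound (M : MixedMethod T p) (hF : HasPowerLaw F σ γ) :
    ∃ δ : M.ineqs → ℝ, Tendsto δ (nToInfty M.ineqs) (𝓝 (σ + γ * p)) ∧
      ∀ᶠ x : M.ineqs in nToInfty M.ineqs, (x.1.s : ℝ) * (x.1.n : ℝ) ^ δ x ≤ F (T x.1.k) ∧
        (x.1.s : ℝ) * (x.1.n : ℝ) ^ δ x ≤ asympRank (T x.1.k) := by
  obtain ⟨g, hg, hm⟩ := M.growth
  refine ⟨fun x => σ + γ * (p + g x.1.n), ?_, ?_⟩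
  · have := (((hg.comp M.tendsto_n).const_add p).const_mul γ).const_add σ
    rwa [add_zero] at this
  · filter_upwards [M.tendsto_n.eventually_ge_atTop 1] with x hx
    have hn : (0 : ℝ) < x.1.n := by exact_mod_cast hx
    have hmx := hm x.1 x.2
    have hm0 : 0 < (x.1.n : ℝ) ^ (p + g x.1.n) := Real.rpow_pos_of_pos hn _
    have hm1 : 1 ≤ x.1.m := by
      have := hm0.trans_le hmx
      exact_mod_cast this
    have hs := M.s_pos x.1 x.2
    have hle : (x.1.s : ℝ) * (x.1.n : ℝ) ^ (σ + γ * (p + g x.1.n))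
        ≤ x.1.s * ((x.1.n : ℝ) ^ σ * (x.1.m : ℝ) ^ γ) := by
      rw [Real.rpow_add hn, mul_comm γ, Real.rpow_mul hn.le]
      have := Real.rpow_le_rpow hm0.le hmx hF.γ_nonneg
      gcongr
    exact ⟨hle.trans (hF.le_value _ _ _ hx hm1 hs _ (M.restricts x.1 x.2)),
      hle.trans (hF.le_asympRank _ _ _ hx hm1 hs _ (M.restricts x.1 x.2))⟩

theorem HasPowerLaw.exponent_pos (hF : HasPowerLaw F σ γ) (hp : 0 ≤ p) : 0 < σ + γ * p :=
  add_pos_of_pos_of_nonneg hF.σ_pos (mul_nonneg hF.γ_nonneg hp)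

/-- Since `F T_k` bounds `n`, the number `k` tends to infinity with `n`. -/
theorem MixedMethod.tendsto_k (M : MixedMethod T p) (hF : HasPowerLaw F σ γ) (hp : 0 ≤ p) :
    Tendsto (fun x : M.ineqs => x.1.k) (nToInfty M.ineqs) atTop := by
  obtain ⟨δ, hδ, hle⟩ := M.exists_lower_bound hF
  have hv := hF.exponent_pos hp
  refine tendsto_atTop.2 fun k₀ => ?_
  have hgrow := (tendsto_rpow_atTop (half_pos hv)).comp
    (tendsto_natCast_atTop_atTop.comp M.tendsto_n)
  filter_upwards [hle, hδ.eventually_const_le (half_lt_self hv),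
    hgrow.eventually_gt_atTop (∑ k ∈ Finset.range k₀, F (T k)),
    M.tendsto_n.eventually_ge_atTop 1] with x h1 h2 h3 h4
  by_contra! hk
  have hn : (1 : ℝ) ≤ x.1.n := by exact_mod_cast h4
  have hs : (1 : ℝ) ≤ x.1.s := by exact_mod_cast M.s_pos x.1 x.2
  have h5 : (x.1.n : ℝ) ^ ((σ + γ * p) / 2) ≤ (x.1.n : ℝ) ^ δ x :=
    Real.rpow_le_rpow_of_exponent_le hn h2
  have h6 : (x.1.n : ℝ) ^ δ x ≤ x.1.s * (x.1.n : ℝ) ^ δ x :=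
    le_mul_of_one_le_left (by positivity) hs
  have h7 := Finset.single_le_sum (f := fun k => F (T k)) (fun k _ => hF.nonneg _)
    (Finset.mem_range.2 hk)
  simp only [Function.comp] at h3
  linarith [h1.1]

theorem MixedMethod.eventually_one_le (M : MixedMethod T p) (hF : HasPowerLaw F σ γ) (hp : 0 ≤ p) :
    ∀ᶠ x : M.ineqs in nToInfty M.ineqs, 1 ≤ F (T x.1.k) ∧ 1 ≤ asympRank (T x.1.k) := by
  obtain ⟨δ, hδ, hle⟩ := M.exists_lower_bound hF
  filter_upwards [hle, hδ.eventually_const_le (hF.exponent_pos hp),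
    M.tendsto_n.eventually_ge_atTop 1] with x h1 h2 h3
  have hn : (1 : ℝ) ≤ x.1.n := by exact_mod_cast h3
  have hs : (1 : ℝ) ≤ x.1.s := by exact_mod_cast M.s_pos x.1 x.2
  have := one_le_mul_of_one_le_of_one_le hs (Real.one_le_rpow hn h2)
  exact ⟨this.trans h1.1, this.trans h1.2⟩

theorem MixedMethod.one_le_seqAsympRank (M : MixedMethod T p) (hT : AlmostExponential T)
    (hF : HasPowerLaw F σ γ) (hp : 0 ≤ p) : 1 ≤ seqAsympRank T := by
  have := M.neBot
  refine ge_of_tendsto_of_frequently (tendsto_nhds_limUnder hT.converges) ?_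
  refine (M.tendsto_k hF hp).frequently (Eventually.frequently ?_)
  filter_upwards [M.eventually_one_le hF hp] with x hx
  exact Real.one_le_rpow hx.2 (by positivity)

theorem MixedMethod.one_le_seqValue (M : MixedMethod T p)
    (hB : BddAbove (Set.range fun n : ℕ => F (T n) ^ ((1 : ℝ) / n)))
    (hF : HasPowerLaw F σ γ) (hp : 0 ≤ p) : 1 ≤ seqValue F T := by
  have := M.neBot
  refine le_limsup_of_frequently_le ?_ hB.isBoundedUnder_of_range
  refine (M.tendsto_k hF hp).frequently (Eventually.frequently ?_)
  filter_upwards [M.eventually_one_le hF hp] with x hx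
  exact Real.one_le_rpow hx.1 (by positivity)

/-- The bound that comes from the asymptotic rank of `T_k` alone. -/
theorem MixedMethod.eventually_le_of_lt_exponent (M : MixedMethod T p) (hF : HasPowerLaw F σ γ)
    (hr : 1 ≤ M.r) {c : ℝ} (hc : c < σ + γ * p) :
    ∀ᶠ x : M.ineqs in nToInfty M.ineqs,
      c ≤ (x.1.k : ℝ) * Real.logb x.1.n M.r - Real.logb x.1.n x.1.s := by
  obtain ⟨δ, hδ, hle⟩ := M.exists_lower_bound hF
  obtain ⟨c', hc1, hc2⟩ := exists_between hc
  filter_upwards [hle, hδ.eventually_const_le hc2, M.rank_le (c' - c) (by linarith),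
    M.tendsto_n.eventually_ge_atTop 2] with x h1 h2 h3 h4
  have hn : (1 : ℝ) < x.1.n := by exact_mod_cast h4
  have hn0 : (0 : ℝ) < x.1.n := by linarith
  have hs : (0 : ℝ) < x.1.s := by exact_mod_cast M.s_pos x.1 x.2
  have hr0 : 0 < M.r := by linarith
  have hL := Real.log_pos hn
  have h5 := Real.log_le_log (by positivity) (h1.2.trans h3)
  rw [Real.log_mul (by positivity) (by positivity), Real.log_mul (by positivity) (by positivity),
    Real.log_rpow hn0, Real.log_rpow hn0, Real.log_pow] at h5
  rw [Real.logb, Real.logb, mul_div_assoc', ← sub_div, le_div_iff₀ hL]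
  have h6 := mul_le_mul_of_nonneg_right h2 hL.le
  linarith

/-- The bound that comes from the growth `F T_k ≤ exp (k y)` for `y > log F({T_n})`. -/
theorem MixedMethod.eventually_le_of_log_seqValue_lt (M : MixedMethod T p)
    (hB : BddAbove (Set.range fun n : ℕ => F (T n) ^ ((1 : ℝ) / n)))
    (hF : HasPowerLaw F σ γ) (hp : 0 ≤ p) (hR : 1 ≤ seqAsympRank T) {κ : ℝ}
    (hκ : M.IsCatalytic κ) {y : ℝ} (hfy : Real.log (seqValue F T) < y)
    (hyR : y ≤ Real.log (seqAsympRank T)) {c : ℝ}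
    (hc : c < (σ + γ * p) * Real.log (seqAsympRank T) / y
      + κ * (Real.log (seqAsympRank T) / y - 1)) :
    ∀ᶠ x : M.ineqs in nToInfty M.ineqs,
      c ≤ (x.1.k : ℝ) * Real.logb x.1.n M.r - Real.logb x.1.n x.1.s := by
  obtain ⟨δ, hδ, hle⟩ := M.exists_lower_bound hF
  obtain ⟨C, hC, hCs⟩ := hκ
  have hf1 := M.one_le_seqValue hB hF hp
  have hy : 0 < y := (Real.log_nonneg hf1).trans_lt hfy
  set R := Real.log (seqAsympRank T) with hRdef
  have hRr : R ≤ Real.log M.r := Real.log_le_log (by linarith) M.seqAsympRank_le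
  have hρ : 1 ≤ R / y := (one_le_div hy).2 hyR
  have hlog : Tendsto (fun x : M.ineqs => Real.log x.1.n) (nToInfty M.ineqs) atTop :=
    Real.tendsto_log_atTop.comp (tendsto_natCast_atTop_atTop.comp M.tendsto_n)
  have hlim : Tendsto (fun x : M.ineqs => R / y * δ x
      + (R / y - 1) * (κ + Real.log C / Real.log x.1.n)) (nToInfty M.ineqs)
      (𝓝 (R / y * (σ + γ * p) + (R / y - 1) * (κ + 0))) :=
    (hδ.const_mul _).add (((hlog.const_div_atTop _).const_add κ).const_mul _)
  have hc' : c < R / y * (σ + γ * p) + (R / y - 1) * (κ + 0) := by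
    refine hc.trans_eq ?_
    ring
  have hval : ∀ᶠ k : ℕ in atTop, F (T k) ^ ((1 : ℝ) / k) < Real.exp y := by
    refine eventually_lt_of_limsup_lt ?_ hB.isBoundedUnder_of_range
    exact (Real.log_lt_iff_lt_exp (zero_lt_one.trans_le hf1)).1 hfy
  filter_upwards [hle, hlim.eventually_const_le hc', (M.tendsto_k hF hp).eventually hval,
    (M.tendsto_k hF hp).eventually_ge_atTop 1, M.tendsto_n.eventually_ge_atTop 2]
    with x h1 h2 h3 h4 h5
  have hn : (1 : ℝ) < x.1.n := by exact_mod_cast h5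
  have hn0 : (0 : ℝ) < x.1.n := by linarith
  have hs : (0 : ℝ) < x.1.s := by exact_mod_cast M.s_pos x.1 x.2
  have hL := Real.log_pos hn
  have hk : (0 : ℝ) < x.1.k := by exact_mod_cast h4
  have hpos : 0 < (x.1.s : ℝ) * (x.1.n : ℝ) ^ δ x := by positivity
  have hFpos := hpos.trans_le h1.1
  have e1 := Real.log_le_log hpos h1.1
  rw [Real.log_mul (by positivity) (by positivity), Real.log_rpow hn0] at e1
  have e2 : Real.log (F (T x.1.k)) ≤ x.1.k * y := by
    have := Real.log_lt_log (by positivity) h3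
    rw [Real.log_rpow hFpos, Real.log_exp, one_div, inv_mul_lt_iff₀ hk] at this
    exact this.le
  have e3 : Real.log C + κ * Real.log x.1.n ≤ Real.log x.1.s := by
    have := Real.log_le_log (by positivity) (hCs x.1 x.2)
    rwa [Real.log_mul hC.ne' (by positivity), Real.log_rpow hn0] at this
  -- multiply `log s + δ log n ≤ k y` by `R / y`
  have e4 : R / y * (Real.log x.1.s + δ x * Real.log x.1.n) ≤ x.1.k * Real.log M.r := by
    have h6 := mul_le_mul_of_nonneg_left (e1.trans e2) (by linarith : 0 ≤ R / y)
    have h7 : R / y * (x.1.k * y) = x.1.k * R := by field_simp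
    rw [h7] at h6
    exact h6.trans (mul_le_mul_of_nonneg_left hRr hk.le)
  have e5 := mul_le_mul_of_nonneg_left e3 (by linarith : 0 ≤ R / y - 1)
  rw [Real.logb, Real.logb, mul_div_assoc', ← sub_div, le_div_iff₀ hL]
  have e6 := mul_le_mul_of_nonneg_right h2 hL.le
  have e7 : (R / y * δ x + (R / y - 1) * (κ + Real.log C / Real.log x.1.n)) * Real.log x.1.n
      = R / y * (δ x * Real.log x.1.n) + (R / y - 1) * (Real.log C + κ * Real.log x.1.n) := by
    field_simp
    ring
  rw [e7] at e6
  linarith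

/-- The barrier for `κ`-catalytic methods. -/
theorem MixedMethod.le_omegaHat (M : MixedMethod T p) (hT : AlmostExponential T) (hp : 0 ≤ p)
    (hF : Admissible F) {κ : ℝ} (hκ0 : 0 ≤ κ) (hκ : M.IsCatalytic κ) :
    ((Real.logb 2 (quasi F p) * Real.log (seqAsympRank T) / Real.log (seqValue F T)
      + κ * (Real.log (seqAsympRank T) / Real.log (seqValue F T) - 1) : ℝ) : EReal)
        ≤ M.omegaHat := by
  have hB := hT.bounded F hF
  obtain ⟨σ, γ, hF⟩ := hF.exists_hasPowerLaw
  have hR := M.one_le_seqAsympRank hT hF hp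
  have hf := M.one_le_seqValue hB hF hp
  have hv := hF.exponent_pos hp
  rw [hF.quasi_eq hp, Real.logb_rpow two_pos one_lt_two.ne']
  refine le_of_forall_lt fun c hc => ?_
  obtain ⟨c', hcc', hc'⟩ := EReal.lt_iff_exists_real_btwn.1 hc
  refine hcc'.trans_le (le_liminf_of_le (by isBoundedDefault) ?_)
  have hc' := EReal.coe_lt_coe_iff.1 hc'
  simp only [EReal.coe_le_coe_iff]
  have hR0 := Real.log_nonneg hR
  have hf0 := Real.log_nonneg hf
  by_cases hcase : 0 < Real.log (seqValue F T) ∧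
      Real.log (seqValue F T) < Real.log (seqAsympRank T)
  · obtain ⟨hf1, hfR⟩ := hcase
    have hcont : Tendsto (fun y => (σ + γ * p) * Real.log (seqAsympRank T) / y
        + κ * (Real.log (seqAsympRank T) / y - 1)) (𝓝[>] Real.log (seqValue F T))
        (𝓝 ((σ + γ * p) * Real.log (seqAsympRank T) / Real.log (seqValue F T)
        + κ * (Real.log (seqAsympRank T) / Real.log (seqValue F T) - 1))) := by
      have hid : Tendsto (fun y : ℝ => y) (𝓝[>] Real.log (seqValue F T))
          (𝓝 (Real.log (seqValue F T))) := tendsto_id.mono_left nhdsWithin_le_nhds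
      exact (tendsto_const_nhds.div hid hf1.ne').add
        (((tendsto_const_nhds.div hid hf1.ne').sub_const 1).const_mul κ)
    obtain ⟨y, h1, h2⟩ := ((hcont.eventually_const_lt hc').and
      (Ioo_mem_nhdsGT hfR)).exists
    exact M.eventually_le_of_log_seqValue_lt hB hF hp hR hκ h2.1 h2.2.le h1
  · -- here the quotient of the logarithms lies in `[0, 1]`
    refine M.eventually_le_of_lt_exponent hF (hR.trans M.seqAsympRank_le) (hc'.trans_le ?_)
    have hρ : Real.log (seqAsympRank T) / Real.log (seqValue F T) ≤ 1 := by
      rcases hf0.eq_or_lt with h | h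
      · rw [← h, div_zero]; exact zero_le_one
      · exact (div_le_one h).2 (not_lt.1 fun h' => hcase ⟨h, h'⟩)
    rw [mul_div_assoc]
    have h1 := mul_le_mul_of_nonneg_left hρ hv.le
    have h2 := mul_nonneg hκ0 (sub_nonneg.2 hρ)
    linarith

theorem MixedMethod.isCatalytic_zero (M : MixedMethod T p) : M.IsCatalytic 0 :=
  ⟨1, one_pos, fun x hx => by simpa using M.s_pos x hx⟩

end Barrier

end RectMM

theorem mainTheorem3 {K : Type*} [Field K] (T : ℕ → RectMM.Tensor K)
    (hT : RectMM.AlmostExponential T) (p : ℝ) (hp : 0 ≤ p) (M : RectMM.MixedMethod T p)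
    (F : RectMM.Tensor K → ℝ) (hF : RectMM.Admissible F) :
    ((Real.logb 2 (RectMM.quasi F p) * Real.log (RectMM.seqAsympRank T)
        / Real.log (RectMM.seqValue F T) : ℝ) : EReal) ≤ M.omegaHat ∧
    ∀ κ : ℝ, 0 ≤ κ → M.IsCatalytic κ →
      ((Real.logb 2 (RectMM.quasi F p) * Real.log (RectMM.seqAsympRank T)
          / Real.log (RectMM.seqValue F T)
        + κ * (Real.log (RectMM.seqAsympRank T) / Real.log (RectMM.seqValue F T) - 1) : ℝ) : EReal)
        ≤ M.omegaHat := by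
  refine ⟨?_, fun κ hκ0 hκ => M.le_omegaHat hT hp hF hκ0 hκ⟩
  -- every method is `0`-catalytic
  simpa only [zero_mul, add_zero] using M.le_omegaHat hT hp hF le_rfl M.isCatalytic_zero
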